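/- Let $\alpha>-1$ and let $f:\mathbb R\to\mathbb C$ be even, continuous and square integrable, with $\int_0^\infty|f(x)|\,dx<\infty$ and, if $-1<\alpha<0$, also $\int_0^\infty |f(x)|\max\{1/x,1\}\,dx<\infty$. Assume that $f$ has an integrable first derivative, i.e. there is $f'\in L^1(\mathbb R)$ with $f(b)-f(a)=\int_a^b f'(x)\,dx$ for all $a,b\in\mathbb R$. Write $\mathcal Fv(y)=\int_{\mathbb R}e^{ixy}v(x)\,dx$ for $v\in L^1(\mathbb R)$, let $\mathcal F^{-1}w(x)=\frac1{2\pi}\int_{\mathbb R}e^{-ixy}w(y)\,dy$ be the inverse transform, extended by continuity to $L^2(\mathbb R)$, and put $\hat f=\mathcal Ff$. For $N\in\mathbb N$, $N\geq1$, and $R>0$ define the band-limited interpolation $$\widehat{f^{(N)}_R}(y)=\sum_{n=-N}^{N}\hat f\Big(n\frac RN\Big)\,\mathrm{sinc}\Big(\frac NR y-n\Big),\qquad \mathrm{sinc}(t)=\frac{\sin(\pi t)}{\pi t},\ \ \mathrm{sinc}(0)=1.$$ Let $(e_\gamma)_{\gamma>0}$ be a mollifier: each $e_\gamma:\mathbb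 R\to[0,\infty)$ is even and integrable with $\int_{\mathbb R} e_\gamma(x)\,dx=1$, and $e_\gamma$ converges to the Dirac delta at $0$ as $\gamma\to0^+$, i.e. $\int_{\mathbb R} e_\gamma(x)\varphi(x)\,dx\to\varphi(0)$ for every $\varphi\in C_c^\infty(\mathbb R)$. Let $\psi_\gamma=\mathcal Fe_\gamma$ be its reconstruction kernel. Then $\widehat{f^{(N)}_R}\cdot\psi_\gamma\in L^2(\mathbb R)$ for all $\gamma>0$, $N\ge1$, $R>0$, and the smoothed estimate $$f^{(N)}_{R,\gamma}=\mathcal F^{-1}\Big(\widehat{f^{(N)}_R}\cdot\psi_\gamma\Big)$$ converges to $f$ in $L^2(\mathbb R)$ as $\gamma\to0^+$, $N\to\infty$, $R\to\infty$ jointly, where the sampling rate $N/R$ tends to infinity as well. That is, for every $\varepsilon>0$ there are $\gamma_0,R_0,B_0>0$ with $\|f^{(N)}_{R,\gamma}-f\|_{L^2(\mathbb R)}<\varepsilon$ whenever $0<\gamma<\gamma_0$, $R>R_0$ and $N/R>B_0$. Moreover, if $f\in C_b(\mathbb R)$ (bounded and continuous), then $f^{(N)}_{R,\gamma}$ has a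 continuous representative for all $\gamma>0$, $N\ge1$, $R>0$, and these representatives converge to $f$ uniformly on $\mathbb R$ in the same limit. -/

import Mathlib

open MeasureTheory Filter Topology Set
open scoped FourierTransform ContDiff

noncomputable section

namespace AlphaSine

/-- Membership (of the restriction of `f` to the positive half-line) in the weighted space
`L¹_{w,α}(ℝ₊)`: it is `L¹(ℝ₊)` for `α ≥ 0`, and
`L¹(ℝ₊) ∩ L¹(ℝ₊, max {1/x, 1} dx)` for `-1 < α < 0`. -/
def MemL1w (α : ℝ) (f : ℝ → ℂ) : Prop :=
  IntegrableOn f (Ioi 0) ∧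
    (α < 0 → IntegrableOn (fun x : ℝ => ((max (1 / x) 1 : ℝ) : ℂ) * f x) (Ioi 0))

/-- `f` has an integrable first derivative: `f` is an indefinite integral of some `f' ∈ L¹(ℝ)`.
(For continuous `f` this is the same as having a weak derivative in `L¹(ℝ)`; it covers
all `C¹` functions with integrable classical derivative.) -/
def HasIntegrableDeriv (f : ℝ → ℂ) : Prop :=
  ∃ f' : ℝ → ℂ, Integrable f' ∧ ∀ a b : ℝ, f b - f a = ∫ x in a..b, f' x

/-- The Fourier transform `𝓕 v (y) = ∫ e^{ixy} v(x) dx` of an integrable function. -/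
def fourierT (v : ℝ → ℂ) (y : ℝ) : ℂ :=
  ∫ x : ℝ, Complex.exp (Complex.I * ((x * y : ℝ) : ℂ)) * v x

open Classical in
/-- The inverse Fourier transform `w ↦ (1/2π) ∫ e^{-ixy} w(y) dy` on `L²(ℝ)`, i.e. the continuous
extension of this integral operator to `L²(ℝ)`. It is expressed through Mathlib's
`L²`-Fourier transform, whose kernel is `e^{-2πixy}`; the value is a representative of the
`L²`-class (and `0` if `w` is not square integrable). -/
def invFourierL2 (w : ℝ → ℂ) (x : ℝ) : ℂ :=
  if hw : MemLp w 2 (volume : Measure ℝ) then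
    (1 / (2 * Real.pi) : ℂ) * (𝓕 (hw.toLp w) : Lp ℂ 2 (volume : Measure ℝ)) (x / (2 * Real.pi))
  else 0

/-- The normalized sinc function `sin (π t) / (π t)`, equal to `1` at `t = 0`. -/
def nsinc (t : ℝ) : ℝ := Real.sinc (Real.pi * t)

/-- The band-limited interpolation of the Fourier transform of `f` from its values at the
points `n R / N`, `-N ≤ n ≤ N`. -/
def interpolant (f : ℝ → ℂ) (N : ℕ) (R : ℝ) (y : ℝ) : ℂ :=
  ∑ n ∈ Finset.Icc (-(N : ℤ)) (N : ℤ),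
    fourierT f ((n : ℝ) * (R / N)) * ((nsinc ((N : ℝ) / R * y - n) : ℝ) : ℂ)

/-- A mollifier family `e_γ`, `γ > 0`: non-negative even functions with integral `1` that converge
to the Dirac delta at `0`, in the sense of distributions, as `γ → 0+`. -/
structure IsMollifier (e : ℝ → ℝ → ℝ) : Prop where
  nonneg : ∀ γ > 0, ∀ x, 0 ≤ e γ x
  even : ∀ γ > 0, ∀ x, e γ (-x) = e γ x
  integrable : ∀ γ > 0, Integrable (e γ)
  integral_eq_one : ∀ γ > 0, ∫ x, e γ x = 1
  tendsto_dirac : ∀ φ : ℝ → ℝ, ContDiff ℝ ∞ φ → HasCompactSupport φ →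
    Tendsto (fun γ => ∫ x, e γ x * φ x) (𝓝[>] 0) (𝓝 (φ 0))

/-- The reconstruction kernel `ψ_γ = 𝓕 e_γ` of the mollifier `e_γ`. -/
def reconKernel (e : ℝ → ℝ → ℝ) (γ : ℝ) : ℝ → ℂ :=
  fourierT (fun x => (e γ x : ℂ))

/-- The product of the interpolant and the reconstruction kernel. -/
def smoothedSpectrum (f : ℝ → ℂ) (e : ℝ → ℝ → ℝ) (γ : ℝ) (N : ℕ) (R : ℝ) (y : ℝ) : ℂ :=
  interpolant f N R y * reconKernel e γ y

/-- The smoothed estimate: the inverse Fourier transform of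
the interpolant multiplied by the reconstruction kernel. -/
def smoothedEstimate (f : ℝ → ℂ) (e : ℝ → ℝ → ℝ) (γ : ℝ) (N : ℕ) (R : ℝ) : ℝ → ℂ :=
  invFourierL2 (smoothedSpectrum f e γ N R)

/-- The limit regime for triples `(γ, N, R)`: jointly `γ → 0+`, `R → ∞` and `N / R → ∞`
(so that `N → ∞` as well; `N / R = 2 B` is the sampling rate). -/
def smoothingLimit : Filter (ℝ × ℕ × ℝ) :=
  comap (fun p => p.1) (𝓝[>] 0) ⊓ comap (fun p => p.2.2) atTop ⊓
    comap (fun p => (p.2.1 : ℝ) / p.2.2) atTop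

end AlphaSine

end

/-! Put `δ = R / N`. The interpolant is the Fourier transform of the partial Fourier sum `S x = (δ /
2π) ∑ f̂(nδ) exp(-i x n δ)`, `|n| ≤ N`, cut off to one period `(-π/δ, π/δ]` (`fourierT_truncated`).
Multiplication by `ψ_γ` becomes convolution with `e_γ`, so the smoothed estimate is `e_γ` convolved
with the truncated sum (`smoothedEstimate_ae_eq`). Convolution with a probability density contracts
both the sup norm and the mean square, so it suffices that the truncated sum tends to `f` in both
senses and that `e_γ * f → f`.

Uniform convergence: pairing `n` with `-n` and using the transform of `f'` gives `S x = (δ / 2π) ∫ f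
- (1/π) ∫ s_N(δ(t - x)) f'(t) dt`, where `s_N` is a partial sum of the sawtooth series
(`partialSum_eq`). These sums are uniformly bounded and converge to the sawtooth away from its
jumps. The jump at `t = x` reproduces `f x`, the term linear in `x` disappears because `∫ f' = 0`,
and the term linear in `t` is `O(δ)` on bounded sets. What remains is the mass of `|f'|` far out or
close to `x`, which is small uniformly in `x`.

Mean square convergence: the period grows as `δ → 0`, so a uniform bound alone is not enough.
Parseval gives `∫ |S|² = ∫ f · conj S`, over a period and over the line respectively
(`integral_partialSum_mul_conj`). Hence `∫ |S - f|²` is controlled by the uniform error times `‖f‖₁`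
plus the tail of `|f|` outside the band. -/

namespace AlphaSine

/-! ### Partial sums of the sawtooth series -/

/-- The partial sums `∑_{1 ≤ n ≤ N} sin (n u) / n` of the sawtooth series. -/
noncomputable def sineSum (N : ℕ) (u : ℝ) : ℝ :=
  ∑ n ∈ Finset.range N, Real.sin ((n + 1) * u) / (n + 1)

theorem continuous_sineSum (N : ℕ) : Continuous (sineSum N) := by
  unfold sineSum
  fun_prop

theorem sineSum_neg (N : ℕ) (u : ℝ) : sineSum N (-u) = -sineSum N u := by
  simp [sineSum, neg_div]

theorem sineSum_add_int_mul (N : ℕ) (u : ℝ) (k : ℤ) :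
    sineSum N (u + k * (2 * Real.pi)) = sineSum N u := by
  unfold sineSum
  refine Finset.sum_congr rfl fun n _ => ?_
  have := Real.sin_add_int_mul_two_pi ((n + 1) * u) ((n + 1) * k)
  push_cast at this
  rw [← this]
  ring_nf

theorem hasDerivAt_sineSum (N : ℕ) (u : ℝ) :
    HasDerivAt (sineSum N) (∑ n ∈ Finset.range N, Real.cos ((n + 1) * u)) u := by
  unfold sineSum
  refine HasDerivAt.fun_sum fun n _ => ?_
  have h : HasDerivAt (fun u : ℝ => ((n : ℝ) + 1) * u) ((n : ℝ) + 1) u := by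
    simpa using (hasDerivAt_id u).const_mul ((n : ℝ) + 1)
  convert! (h.sin.div_const ((n : ℝ) + 1)) using 1
  field_simp

/-- The Dirichlet kernel: multiplication by `2 sin (u/2)` makes the cosine sum telescope. -/
theorem two_mul_sin_mul_sum_cos (N : ℕ) (u : ℝ) :
    2 * Real.sin (u / 2) * (∑ n ∈ Finset.range N, Real.cos ((n + 1) * u) + 1 / 2) =
      Real.sin ((N + 1 / 2) * u) := by
  induction N with
  | zero => simp; ring_nf
  | succ N ih =>
    have h := Real.sin_sub_sin (((N + 1 : ℕ) + 1 / 2) * u) ((N + 1 / 2) * u)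
    have e1 : (((N + 1 : ℕ) + 1 / 2) * u - (N + 1 / 2) * u) / 2 = u / 2 := by push_cast; ring
    have e2 : (((N + 1 : ℕ) + 1 / 2) * u + (N + 1 / 2) * u) / 2 = (N + 1) * u := by
      push_cast; ring
    rw [e1, e2] at h
    rw [Finset.sum_range_succ]
    linear_combination ih - h

/-- The partial sums of the sawtooth series converge at rate `1 / (N u)`. -/
theorem abs_sineSum_sub_le {u : ℝ} (N : ℕ) (h0 : 0 < u) (h1 : u ≤ Real.pi) :
    |sineSum N u - (Real.pi - u) / 2| ≤ 2 / ((2 * N + 1) * Real.sin (u / 2)) := by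
  have hs : ∀ v ∈ Icc u Real.pi, 0 < Real.sin (v / 2) := fun v hv =>
    Real.sin_pos_of_pos_of_lt_pi (by linarith [hv.1]) (by linarith [hv.2, Real.pi_pos])
  have hc : ∀ v ∈ Icc u Real.pi, 0 ≤ Real.cos (v / 2) := fun v hv =>
    Real.cos_nonneg_of_mem_Icc ⟨by linarith [hv.1, Real.pi_pos], by linarith [hv.2]⟩
  have hN : (0 : ℝ) < 2 * N + 1 := by positivity
  set b : ℝ → ℝ := fun v => ((2 * N + 1) * Real.sin (v / 2))⁻¹ with hb
  -- One integration by parts of the Dirichlet kernel: since `(N + 1/2) b v = 1 / (2 sin (v/2))`,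
  -- the added term cancels the oscillating derivative of the error and leaves only `cos ((N + 1/2)
  -- v) * b' v`.
  set G : ℝ → ℝ := fun v => sineSum N v - (Real.pi - v) / 2 +
    Real.cos ((N + 1 / 2) * v) * b v with hG
  have hbd : ∀ v ∈ Icc u Real.pi, HasDerivAt b
      (-Real.cos (v / 2) / (2 * (2 * N + 1) * Real.sin (v / 2) ^ 2)) v := by
    intro v hv
    have h : HasDerivAt (fun v : ℝ => v / 2) (1 / 2) v := (hasDerivAt_id v).div_const 2
    have := ((h.sin.const_mul (2 * (N : ℝ) + 1)).inv (mul_pos hN (hs v hv)).ne')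
    convert! this using 1
    have := (hs v hv).ne'
    field_simp
  have hGd : ∀ v ∈ Icc u Real.pi, HasDerivAt G (Real.cos ((N + 1 / 2) * v) *
      (-Real.cos (v / 2) / (2 * (2 * N + 1) * Real.sin (v / 2) ^ 2))) v := by
    intro v hv
    have h : HasDerivAt (fun v : ℝ => ((N : ℝ) + 1 / 2) * v) ((N : ℝ) + 1 / 2) v := by
      simpa using (hasDerivAt_id v).const_mul ((N : ℝ) + 1 / 2)
    have := ((hasDerivAt_sineSum N v).sub (((hasDerivAt_id v).const_sub Real.pi).div_const 2)).add
      (h.cos.mul (hbd v hv))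
    convert! this using 1
    have hne := (hs v hv).ne'
    have key := two_mul_sin_mul_sum_cos N v
    have e : ∑ n ∈ Finset.range N, Real.cos ((n + 1) * v) =
      Real.sin ((N + 1 / 2) * v) / (2 * Real.sin (v / 2)) - 1 / 2 := by
      rw [eq_sub_iff_add_eq, eq_div_iff (by positivity), mul_comm]
      exact key
    rw [e]
    simp only [hb]
    field_simp
    ring
  have hbound : ∀ v ∈ Icc u Real.pi, |Real.cos ((N + 1 / 2) * v) *
      (-Real.cos (v / 2) / (2 * (2 * N + 1) * Real.sin (v / 2) ^ 2))| ≤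
      Real.cos (v / 2) / (2 * (2 * N + 1) * Real.sin (v / 2) ^ 2) := by
    intro v hv
    have hp : 0 ≤ Real.cos (v / 2) / (2 * (2 * N + 1) * Real.sin (v / 2) ^ 2) :=
      div_nonneg (hc v hv) (by positivity)
    rw [neg_div, abs_mul, abs_neg, abs_of_nonneg hp]
    exact mul_le_of_le_one_left hp (Real.abs_cos_le_one _)
  -- Since `|G'| ≤ -b'`, both monotonicities together bound `|G u - G π|` by `b u - b π`, and `G π =
  -- 0`.
  have hm1 : AntitoneOn (fun v => G v + b v) (Icc u Real.pi) := by
    refine antitoneOn_of_hasDerivWithinAt_nonpos (convex_Icc _ _)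
      (fun v hv => ((hGd v hv).add (hbd v hv)).continuousAt.continuousWithinAt)
      (fun v hv => ((hGd v (interior_subset hv)).add
        (hbd v (interior_subset hv))).hasDerivWithinAt) fun v hv => ?_
    have := (abs_le.1 (hbound v (interior_subset hv))).2
    rw [neg_div] at this ⊢
    linarith
  have hm2 : MonotoneOn (fun v => G v - b v) (Icc u Real.pi) := by
    refine monotoneOn_of_hasDerivWithinAt_nonneg (convex_Icc _ _)
      (fun v hv => ((hGd v hv).sub (hbd v hv)).continuousAt.continuousWithinAt)
      (fun v hv => ((hGd v (interior_subset hv)).sub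
        (hbd v (interior_subset hv))).hasDerivWithinAt) fun v hv => ?_
    have := (abs_le.1 (hbound v (interior_subset hv))).1
    rw [neg_div] at this ⊢
    linarith
  have hu : u ∈ Icc u Real.pi := ⟨le_rfl, h1⟩
  have hpi : Real.pi ∈ Icc u Real.pi := ⟨h1, le_rfl⟩
  have hGpi : G Real.pi = 0 := by
    have e1 : sineSum N Real.pi = 0 := Finset.sum_eq_zero fun n _ => by
      have := Real.sin_nat_mul_pi (n + 1)
      push_cast at this
      rw [this, zero_div]
    have e2 : Real.cos ((N + 1 / 2) * Real.pi) = 0 := by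
      rw [add_mul, one_div, inv_mul_eq_div, Real.cos_add_pi_div_two, Real.sin_nat_mul_pi, neg_zero]
    simp only [hG, e1, e2]
    ring
  have g1 := hm1 hu hpi h1
  have g2 := hm2 hu hpi h1
  have hbpi : 0 < b Real.pi := inv_pos.2 (mul_pos hN (hs _ hpi))
  have hbu : 0 < b u := inv_pos.2 (mul_pos hN (hs _ hu))
  simp only [hGpi] at g1 g2
  have hc1 : |Real.cos ((N + 1 / 2) * u) * b u| ≤ b u := by
    rw [abs_mul, abs_of_pos hbu]
    exact mul_le_of_le_one_left hbu.le (Real.abs_cos_le_one _)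
  have e : 2 / ((2 * N + 1) * Real.sin (u / 2)) = 2 * b u := by rw [hb, div_eq_mul_inv]
  rw [e]
  simp only [hG] at g1 g2
  rw [abs_le] at hc1 ⊢
  constructor <;> linarith [hc1.1, hc1.2]

theorem abs_sineSum_sub_le' {u : ℝ} {N : ℕ} (hN : 0 < N) (h0 : 0 < u) (h1 : u ≤ Real.pi) :
    |sineSum N u - (Real.pi - u) / 2| ≤ Real.pi / (N * u) := by
  refine (abs_sineSum_sub_le N h0 h1).trans ?_
  have hs : u / Real.pi ≤ Real.sin (u / 2) := by
    have := Real.mul_le_sin (x := u / 2) (by linarith) (by linarith)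
    refine le_trans (le_of_eq ?_) this
    field_simp
  have hN' : (0 : ℝ) < N := by exact_mod_cast hN
  have hp := Real.pi_pos
  calc 2 / ((2 * N + 1) * Real.sin (u / 2)) ≤ 2 / ((2 * N) * (u / Real.pi)) := by
        gcongr
        linarith
    _ = Real.pi / (N * u) := by field_simp

theorem sineSum_two_pi_sub (N : ℕ) (u : ℝ) :
    sineSum N (2 * Real.pi - u) = -sineSum N u := by
  have := sineSum_add_int_mul N (-u) 1
  rw [sineSum_neg] at this
  rw [← this]
  congr 1
  push_cast
  ring

/-- The rate of convergence of the sawtooth series on a full period. -/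
theorem abs_sineSum_sub_le_of_lt_two_pi {u η : ℝ} {N : ℕ} (hN : 0 < N) (hη : 0 < η) (h0 : η ≤ u)
    (h1 : u ≤ 2 * Real.pi - η) :
    |sineSum N u - (Real.pi - u) / 2| ≤ Real.pi / (N * η) := by
  have hN' : (0 : ℝ) < N := by exact_mod_cast hN
  have hp := Real.pi_pos
  rcases le_total u Real.pi with h | h
  · refine (abs_sineSum_sub_le' hN (hη.trans_le h0) h).trans ?_
    gcongr
  · have := abs_sineSum_sub_le' (u := 2 * Real.pi - u) hN (by linarith) (by linarith)
    rw [sineSum_two_pi_sub, ← abs_neg] at this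
    refine (le_of_eq ?_).trans (this.trans ?_)
    · congr 1
      ring
    · gcongr
      linarith

/-- The partial sums of the sawtooth series are uniformly bounded. -/
theorem abs_sineSum_le (N : ℕ) (u : ℝ) : |sineSum N u| ≤ 6 := by
  have hp := Real.pi_pos
  have hp4 := Real.pi_lt_four
  have hp3 : Real.pi < 3.2 := by linarith [Real.pi_lt_d2]
  rcases Nat.eq_zero_or_pos N with rfl | hN
  · simp [sineSum]
  have hN' : (0 : ℝ) < N := by exact_mod_cast hN
  have main : ∀ v : ℝ, 0 ≤ v → v ≤ Real.pi → |sineSum N v| ≤ 6 := by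
    intro v h0 h1
    -- If `N v ≤ 1`, termwise `|sin x| ≤ |x|` bounds the sum by `N v`. Otherwise the error to the
    -- sawtooth is at most `π / (N v) ≤ π`, and the sawtooth itself is at most `π / 2`.
    rcases le_total (N * v) 1 with h | h
    · calc |sineSum N v| ≤ ∑ n ∈ Finset.range N, |Real.sin ((n + 1) * v) / (n + 1)| :=
            Finset.abs_sum_le_sum_abs _ _
        _ ≤ ∑ n ∈ Finset.range N, v := by
            refine Finset.sum_le_sum fun n _ => ?_
            have hn : (0 : ℝ) < n + 1 := by positivity
            rw [abs_div, abs_of_pos hn, div_le_iff₀ hn]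
            refine (Real.abs_sin_le_abs (x := (n + 1) * v)).trans ?_
            rw [abs_of_nonneg (by positivity), mul_comm]
        _ ≤ 6 := by simp; linarith
    · have hv : 0 < v := by
        rcases h0.eq_or_lt with h' | h'
        · rw [← h'] at h; norm_num at h
        · exact h'
      have := abs_sineSum_sub_le' hN hv h1
      have h2 : Real.pi / (N * v) ≤ Real.pi := div_le_self hp.le h
      rw [abs_le] at this ⊢
      constructor <;> linarith [this.1, this.2]
  set v := toIocMod Real.two_pi_pos (-Real.pi) u with hv
  have hvm := toIocMod_mem_Ioc Real.two_pi_pos (-Real.pi) u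
  have hu : u = v + toIocDiv Real.two_pi_pos (-Real.pi) u * (2 * Real.pi) := by
    have := toIocMod_add_toIocDiv_zsmul Real.two_pi_pos (-Real.pi) u
    rw [← this, zsmul_eq_mul]
    simp [hv]
  rw [hu, sineSum_add_int_mul]
  rcases le_total 0 v with h | h
  · exact main v h (by linarith [hvm.2])
  · have := main (-v) (by linarith) (by linarith [hvm.1])
    rwa [sineSum_neg, abs_neg] at this

/-! ### Integrable functions with an integrable derivative -/

theorem integrable_of_even {f : ℝ → ℂ} (he : ∀ x, f (-x) = f x) (h : IntegrableOn f (Ioi 0)) :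
    Integrable f := by
  have h1 : IntegrableOn f (Iio 0) := by
    simpa only [he, neg_zero] using (show IntegrableOn f (Ioi (-0)) by simpa using h).comp_neg_Iio
  rw [← integrableOn_univ, ← Iic_union_Ioi (a := (0 : ℝ))]
  exact (Iff.mpr integrableOn_Iic_iff_integrableOn_Iio h1).union h

section Primitive

variable {f f' : ℝ → ℂ}

/-- Integrability of `f'` forces a limit to exist; integrability of `f` forces it to be zero. -/
theorem tendsto_atTop_zero_of_primitive (hf : Integrable f) (hf' : Integrable f')
    (hd : ∀ a b : ℝ, f b - f a = ∫ x in a..b, f' x) : Tendsto f atTop (𝓝 0) := by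
  have h : Tendsto f atTop (𝓝 (f 0 + ∫ x in Ioi 0, f' x)) := by
    refine ((intervalIntegral_tendsto_integral_Ioi 0 hf'.integrableOn
      tendsto_id).const_add (f 0)).congr fun x => ?_
    simp [← hd]
  rwa [IntegrableAtFilter.eq_zero_of_tendsto (hf.integrableAtFilter _) (fun s hs => ?_) h] at h
  obtain ⟨a, ha⟩ := mem_atTop_sets.1 hs
  rw [← top_le_iff, ← Real.volume_Ici (a := a)]
  exact measure_mono ha

theorem tendsto_atBot_zero_of_primitive (hf : Integrable f) (hf' : Integrable f')
    (hd : ∀ a b : ℝ, f b - f a = ∫ x in a..b, f' x) : Tendsto f atBot (𝓝 0) := by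
  have h : Tendsto f atBot (𝓝 (f 0 - ∫ x in Iic 0, f' x)) := by
    refine ((intervalIntegral_tendsto_integral_Iic 0 hf'.integrableOn
      tendsto_id).const_sub (f 0)).congr fun x => ?_
    simp [← hd]
  rwa [IntegrableAtFilter.eq_zero_of_tendsto (hf.integrableAtFilter _) (fun s hs => ?_) h] at h
  obtain ⟨a, ha⟩ := mem_atBot_sets.1 hs
  rw [← top_le_iff, ← Real.volume_Iic (a := a)]
  exact measure_mono ha

theorem integral_Ioi_eq_neg_of_primitive (hf : Integrable f) (hf' : Integrable f')
    (hd : ∀ a b : ℝ, f b - f a = ∫ x in a..b, f' x) (x : ℝ) : ∫ t in Ioi x, f' t = -f x := by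
  have h1 := intervalIntegral_tendsto_integral_Ioi x hf'.integrableOn tendsto_id
  have h2 := (tendsto_atTop_zero_of_primitive hf hf' hd).sub_const (f x)
  simp only [id, ← hd, zero_sub] at h1 h2
  exact tendsto_nhds_unique h1 h2

theorem integral_Iic_eq_of_primitive (hf : Integrable f) (hf' : Integrable f')
    (hd : ∀ a b : ℝ, f b - f a = ∫ x in a..b, f' x) (x : ℝ) : ∫ t in Iic x, f' t = f x := by
  have h1 := intervalIntegral_tendsto_integral_Iic x hf'.integrableOn tendsto_id
  have h2 := (tendsto_atBot_zero_of_primitive hf hf' hd).const_sub (f x)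
  simp only [id, ← hd, sub_zero] at h1 h2
  exact tendsto_nhds_unique h1 h2

theorem integral_eq_zero_of_primitive (hf : Integrable f) (hf' : Integrable f')
    (hd : ∀ a b : ℝ, f b - f a = ∫ x in a..b, f' x) : ∫ t, f' t = 0 := by
  rw [← intervalIntegral.integral_Iic_add_Ioi (b := 0) hf'.integrableOn hf'.integrableOn,
    integral_Iic_eq_of_primitive hf hf' hd, integral_Ioi_eq_neg_of_primitive hf hf' hd,
    add_neg_cancel]

/-- The jump of the sawtooth acts on `f'` through this sign kernel, and this is how `f x` is
recovered. -/
theorem integral_sign_mul_of_primitive (hf : Integrable f) (hf' : Integrable f')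
    (hd : ∀ a b : ℝ, f b - f a = ∫ x in a..b, f' x) (x : ℝ) :
    ∫ t, ((if x < t then 1 else -1 : ℝ) : ℂ) * f' t = -2 * f x := by
  have e1 : ∀ t ∈ Iic x, ((if x < t then 1 else -1 : ℝ) : ℂ) * f' t = -f' t := fun t ht => by
    simp [not_lt.2 (mem_Iic.1 ht)]
  have e2 : ∀ t ∈ Ioi x, ((if x < t then 1 else -1 : ℝ) : ℂ) * f' t = f' t := fun t ht => by
    simp [mem_Ioi.1 ht]
  rw [← intervalIntegral.integral_Iic_add_Ioi (b := x)
    (hf'.neg.integrableOn.congr_fun (fun t ht => (e1 t ht).symm) measurableSet_Iic)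
    (hf'.integrableOn.congr_fun (fun t ht => (e2 t ht).symm) measurableSet_Ioi),
    setIntegral_congr_fun measurableSet_Iic e1, setIntegral_congr_fun measurableSet_Ioi e2,
    integral_neg, integral_Iic_eq_of_primitive hf hf' hd,
    integral_Ioi_eq_neg_of_primitive hf hf' hd]
  ring

theorem norm_le_of_primitive (hf : Integrable f) (hf' : Integrable f')
    (hd : ∀ a b : ℝ, f b - f a = ∫ x in a..b, f' x) (x : ℝ) : ‖f x‖ ≤ ∫ t, ‖f' t‖ := by
  rw [← integral_Iic_eq_of_primitive hf hf' hd]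
  exact (norm_integral_le_integral_norm _).trans
    (setIntegral_le_integral hf'.norm (ae_of_all _ fun _ => norm_nonneg _))

end Primitive

/-! ### The Fourier transform of the derivative -/

theorem norm_cexp_I_mul (x : ℝ) : ‖Complex.exp (Complex.I * (x : ℂ))‖ = 1 := by
  rw [mul_comm, Complex.norm_exp_ofReal_mul_I]

theorem integrable_cexp_mul {v : ℝ → ℂ} (hv : Integrable v) (y : ℝ) :
    Integrable (fun x : ℝ => Complex.exp (Complex.I * ((x * y : ℝ) : ℂ)) * v x) := by
  refine hv.bdd_mul (c := 1) (Continuous.aestronglyMeasurable (by fun_prop))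
    (ae_of_all _ fun x => ?_)
  rw [norm_cexp_I_mul]

theorem norm_fourierT_le (v : ℝ → ℂ) (y : ℝ) : ‖fourierT v y‖ ≤ ∫ x, ‖v x‖ := by
  refine (norm_integral_le_integral_norm _).trans (le_of_eq ?_)
  simp_rw [norm_mul, norm_cexp_I_mul, one_mul]

theorem fourierT_comp_sub_right (v : ℝ → ℂ) (h y : ℝ) :
    fourierT (fun x => v (x - h)) y =
      Complex.exp (Complex.I * ((h * y : ℝ) : ℂ)) * fourierT v y := by
  unfold fourierT
  rw [← integral_add_right_eq_self _ h, ← integral_const_mul]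
  refine integral_congr_ae (ae_of_all _ fun x => ?_)
  simp only [add_sub_cancel_right]
  rw [← mul_assoc, ← Complex.exp_add]
  congr 2
  push_cast
  ring

/-- The difference `f x - f (x - h)` is the average-free convolution of `f'` with the indicator of
`(0, h]`; Fubini then factors the transform. -/
theorem fourierT_sub_translate {f f' : ℝ → ℂ} (hf' : Integrable f')
    (hd : ∀ a b : ℝ, f b - f a = ∫ x in a..b, f' x) {h : ℝ} (hh : 0 ≤ h) (y : ℝ) :
    fourierT (fun x => f x - f (x - h)) y =
      (∫ s in (0 : ℝ)..h, Complex.exp (Complex.I * ((s * y : ℝ) : ℂ))) * fourierT f' y := by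
  have hint : Integrable (fun p : ℝ × ℝ => Complex.exp (Complex.I * ((p.1 * y : ℝ) : ℂ)) *
      f' (p.1 - p.2)) (volume.prod (volume.restrict (Ioc 0 h))) := by
    have h1 : Integrable (fun p : ℝ × ℝ => ContinuousLinearMap.mul ℂ ℂ (1 : ℂ) (f' (p.1 - p.2)))
        (volume.prod (volume.restrict (Ioc 0 h))) :=
      Integrable.convolution_integrand (ν := volume.restrict (Ioc 0 h)) (f := fun _ => (1 : ℂ))
        (ContinuousLinearMap.mul ℂ ℂ) (integrable_const _) hf'
    simp only [ContinuousLinearMap.mul_apply', one_mul] at h1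
    refine h1.bdd_mul (c := 1) (Continuous.aestronglyMeasurable (by fun_prop))
      (ae_of_all _ fun x => ?_)
    rw [norm_cexp_I_mul]
  calc fourierT (fun x => f x - f (x - h)) y
      = ∫ x, ∫ s in Ioc 0 h, Complex.exp (Complex.I * ((x * y : ℝ) : ℂ)) * f' (x - s) := by
        refine integral_congr_ae (ae_of_all _ fun x => ?_)
        simp only
        rw [hd, integral_const_mul, ← intervalIntegral.integral_of_le hh,
          intervalIntegral.integral_comp_sub_left (fun t => f' t) x, sub_zero]
    _ = ∫ s in Ioc 0 h, fourierT (fun x => f' (x - s)) y := integral_integral_swap hint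
    _ = _ := by
        simp_rw [fourierT_comp_sub_right]
        rw [integral_mul_const, ← intervalIntegral.integral_of_le hh]

/-- The Fourier transform of the derivative of an absolutely continuous function. -/
theorem fourierT_deriv {f f' : ℝ → ℂ} (hf : Integrable f) (hf' : Integrable f')
    (hd : ∀ a b : ℝ, f b - f a = ∫ x in a..b, f' x) (y : ℝ) :
    fourierT f' y = -Complex.I * y * fourierT f y := by
  rcases eq_or_ne y 0 with rfl | hy
  · simp [fourierT, integral_eq_zero_of_primitive hf hf' hd]
  have hy' : (y : ℂ) ≠ 0 := by exact_mod_cast hy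
  -- Translation by half a period multiplies the transform by `-1`, so the translation identity
  -- determines `fourierT f y` without boundary terms.
  set h := Real.pi / |y| with hh
  have hexp : Complex.exp (Complex.I * ((h * y : ℝ) : ℂ)) = -1 := by
    rcases lt_or_gt_of_ne hy with h0 | h0
    · rw [hh, abs_of_neg h0, show Real.pi / -y * y = -Real.pi by field_simp]
      push_cast
      rw [mul_neg, mul_comm, Complex.exp_neg, Complex.exp_pi_mul_I]
      norm_num
    · rw [hh, abs_of_pos h0, div_mul_cancel₀ _ hy, mul_comm, Complex.exp_pi_mul_I]
  have h1 := fourierT_sub_translate hf' hd (h := h) (by positivity) y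
  have h2 : fourierT (fun x => f x - f (x - h)) y = 2 * fourierT f y := by
    have e : fourierT (fun x => f x - f (x - h)) y =
        fourierT f y - fourierT (fun x => f (x - h)) y := by
      unfold fourierT
      rw [← integral_sub (integrable_cexp_mul hf y) (integrable_cexp_mul (hf.comp_sub_right h) y)]
      simp_rw [mul_sub]
    rw [e, fourierT_comp_sub_right, hexp]
    ring
  have h3 : ∫ s in (0 : ℝ)..h, Complex.exp (Complex.I * ((s * y : ℝ) : ℂ)) =
      -2 / (Complex.I * y) := by
    have := integral_exp_mul_complex (a := 0) (b := h) (c := Complex.I * y)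
      (mul_ne_zero Complex.I_ne_zero hy')
    have e : ∀ s : ℝ, Complex.exp (Complex.I * ((s * y : ℝ) : ℂ)) =
        Complex.exp (Complex.I * y * s) := fun s => by push_cast; ring_nf
    simp_rw [e, this, ← e, hexp]
    norm_num
  rw [h2, h3, div_mul_eq_mul_div, eq_div_iff (mul_ne_zero Complex.I_ne_zero hy')] at h1
  linear_combination (1 / 2 : ℂ) * h1

/-! ### Partial Fourier sums and their sawtooth representation -/

/-- The inverse Fourier transform of the interpolant with sampling step `δ` on the band
`(-π / δ, π / δ]`: a partial sum of a Fourier series. -/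
noncomputable def partialSum (f : ℝ → ℂ) (δ : ℝ) (N : ℕ) (x : ℝ) : ℂ :=
  ((δ / (2 * Real.pi) : ℝ) : ℂ) * ∑ n ∈ Finset.Icc (-(N : ℤ)) (N : ℤ),
    fourierT f (n * δ) * Complex.exp (Complex.I * ((-(x * (n * δ)) : ℝ) : ℂ))

theorem continuous_partialSum (f : ℝ → ℂ) (δ : ℝ) (N : ℕ) : Continuous (partialSum f δ N) := by
  unfold partialSum
  fun_prop

theorem sum_Icc_neg_eq {M : Type*} [AddCommMonoid M] (g : ℤ → M) (N : ℕ) :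
    ∑ n ∈ Finset.Icc (-(N : ℤ)) (N : ℤ), g n =
      g 0 + ∑ n ∈ Finset.range N, (g (n + 1) + g (-(n + 1))) := by
  induction N with
  | zero => simp
  | succ N ih =>
    have e : Finset.Icc (-((N + 1 : ℕ) : ℤ)) ((N + 1 : ℕ) : ℤ) =
        insert (-((N : ℤ) + 1)) (insert ((N : ℤ) + 1) (Finset.Icc (-(N : ℤ)) N)) := by
      ext k
      simp only [Finset.mem_insert, Finset.mem_Icc]
      push_cast
      omega
    rw [e, Finset.sum_insert, Finset.sum_insert, ih, Finset.sum_range_succ]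
    · abel
    · simp
    · simp only [Finset.mem_insert, Finset.mem_Icc]
      omega

section Primitive

variable {f f' : ℝ → ℂ}

/-- Passing from `f` to `f'` gains the factor `i / y`, odd in `y`; hence the two exponentials
combine to a sine, and `y = n δ` yields the terms of the sawtooth series. -/
theorem fourierT_pair_eq (hf : Integrable f) (hf' : Integrable f')
    (hd : ∀ a b : ℝ, f b - f a = ∫ x in a..b, f' x) {y : ℝ} (hy : y ≠ 0) (x : ℝ) :
    fourierT f y * Complex.exp (Complex.I * ((-(x * y) : ℝ) : ℂ)) +
      fourierT f (-y) * Complex.exp (Complex.I * ((x * y : ℝ) : ℂ)) =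
      ∫ t, ((-(2 / y) * Real.sin (y * (t - x)) : ℝ) : ℂ) * f' t := by
  have hy' : (y : ℂ) ≠ 0 := by exact_mod_cast hy
  have h1 : fourierT f y = Complex.I / y * fourierT f' y := by
    rw [fourierT_deriv hf hf' hd y]
    field_simp
    linear_combination (fourierT f y) * Complex.I_sq
  have h2 : fourierT f (-y) = -(Complex.I / y) * fourierT f' (-y) := by
    rw [fourierT_deriv hf hf' hd (-y)]
    push_cast
    field_simp
    linear_combination (fourierT f (-y)) * Complex.I_sq
  rw [h1, h2]
  unfold fourierT
  rw [← integral_const_mul, ← integral_const_mul, ← integral_mul_const, ← integral_mul_const,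
    ← integral_add (((integrable_cexp_mul hf' y).const_mul _).mul_const _)
      (((integrable_cexp_mul hf' (-y)).const_mul _).mul_const _)]
  refine integral_congr_ae (ae_of_all _ fun t => ?_)
  simp only
  have e1 : Complex.exp (Complex.I * ((t * y : ℝ) : ℂ)) *
      Complex.exp (Complex.I * ((-(x * y) : ℝ) : ℂ)) =
      Complex.exp (((y * (t - x) : ℝ) : ℂ) * Complex.I) := by
    rw [← Complex.exp_add]
    congr 1
    push_cast
    ring
  have e2 : Complex.exp (Complex.I * ((t * -y : ℝ) : ℂ)) *
      Complex.exp (Complex.I * ((x * y : ℝ) : ℂ)) =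
      Complex.exp (-((y * (t - x) : ℝ) : ℂ) * Complex.I) := by
    rw [← Complex.exp_add]
    congr 1
    push_cast
    ring
  have e3 := Complex.two_sin ((y * (t - x) : ℝ) : ℂ)
  rw [← e1, ← e2] at e3
  have e4 : ((-(2 / y) * Real.sin (y * (t - x)) : ℝ) : ℂ) =
      -(1 / y) * (2 * Complex.sin ((y * (t - x) : ℝ) : ℂ)) := by
    push_cast
    ring
  rw [e4, e3]
  ring

theorem integrable_real_mul {g : ℝ → ℂ} (hg : Integrable g) {k : ℝ → ℝ}
    (hk : AEStronglyMeasurable k) {C : ℝ} (hC : ∀ t, |k t| ≤ C) :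
    Integrable (fun t => (k t : ℂ) * g t) := by
  refine hg.bdd_mul (c := C) (Complex.continuous_ofReal.comp_aestronglyMeasurable hk)
    (ae_of_all _ fun t => ?_)
  simpa using hC t

/-- The partial sum as a singular integral of the derivative against the sawtooth sums. -/
theorem partialSum_eq (hf : Integrable f) (hf' : Integrable f')
    (hd : ∀ a b : ℝ, f b - f a = ∫ x in a..b, f' x) {δ : ℝ} (hδ : 0 < δ) (N : ℕ) (x : ℝ) :
    partialSum f δ N x = ((δ / (2 * Real.pi) : ℝ) : ℂ) * (∫ t, f t) -
      ∫ t, ((sineSum N (δ * (t - x)) / Real.pi : ℝ) : ℂ) * f' t := by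
  have hp := Real.pi_pos
  unfold partialSum
  rw [sum_Icc_neg_eq, mul_add, sub_eq_add_neg]
  congr 1
  · simp [fourierT]
  · have e : ∀ n : ℕ, fourierT f (((n + 1 : ℤ) : ℝ) * δ) *
        Complex.exp (Complex.I * ((-(x * (((n + 1 : ℤ) : ℝ) * δ)) : ℝ) : ℂ)) +
        fourierT f (((-(n + 1) : ℤ) : ℝ) * δ) *
        Complex.exp (Complex.I * ((-(x * (((-(n + 1) : ℤ) : ℝ) * δ)) : ℝ) : ℂ)) =
        ∫ t, ((-(2 / ((n + 1) * δ)) * Real.sin ((n + 1) * δ * (t - x)) : ℝ) : ℂ) * f' t := by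
      intro n
      have hy : ((n : ℝ) + 1) * δ ≠ 0 := by positivity
      rw [← fourierT_pair_eq hf hf' hd hy x]
      push_cast
      ring_nf
    simp_rw [e]
    rw [← integral_finsetSum, ← integral_const_mul, ← integral_neg]
    · refine integral_congr_ae (ae_of_all _ fun t => ?_)
      simp only
      rw [← Finset.sum_mul, ← Complex.ofReal_sum, ← mul_assoc, ← Complex.ofReal_mul,
        ← neg_mul, ← Complex.ofReal_neg]
      congr 2
      unfold sineSum
      rw [Finset.mul_sum, Finset.sum_div, ← Finset.sum_neg_distrib]
      refine Finset.sum_congr rfl fun n _ => ?_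
      rw [← mul_assoc ((n : ℝ) + 1)]
      field_simp
    · intro n _
      refine integrable_real_mul hf' (Continuous.aestronglyMeasurable (by fun_prop))
        (C := |2 / ((n + 1) * δ)|) fun t => ?_
      rw [abs_mul, abs_neg]
      exact mul_le_of_le_one_right (abs_nonneg _) (Real.abs_sin_le_one _)

theorem norm_partialSum_le (hf : Integrable f) (hf' : Integrable f')
    (hd : ∀ a b : ℝ, f b - f a = ∫ x in a..b, f' x) {δ : ℝ} (hδ : 0 < δ) (N : ℕ) (x : ℝ) :
    ‖partialSum f δ N x‖ ≤ δ * (∫ t, ‖f t‖) + 2 * ∫ t, ‖f' t‖ := by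
  have hp := Real.pi_gt_three
  rw [partialSum_eq hf hf' hd hδ]
  refine (norm_sub_le _ _).trans (add_le_add ?_ ?_)
  · rw [norm_mul, Complex.norm_real, Real.norm_of_nonneg (by positivity)]
    refine mul_le_mul ?_ (norm_integral_le_integral_norm _) (norm_nonneg _) hδ.le
    exact div_le_self hδ.le (by linarith)
  · rw [← integral_const_mul]
    refine norm_integral_le_of_norm_le (hf'.norm.const_mul 2) (ae_of_all _ fun t => ?_)
    rw [norm_mul, Complex.norm_real, Real.norm_eq_abs, abs_div, abs_of_pos Real.pi_pos]
    gcongr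
    rw [div_le_iff₀ Real.pi_pos]
    linarith [abs_sineSum_le N (δ * (t - x))]

/-- The constant `δ x / (2π)` may be subtracted freely because `∫ f' = 0`; it removes the
`x`-dependence of the linear part of the sawtooth. The bound is `2 + 1/2 + 1/2`. -/
theorem abs_sawtooth_error_le {δ x t : ℝ} (hδ : 0 < δ) (N : ℕ) (hx : |x| ≤ Real.pi / δ) :
    |sineSum N (δ * (t - x)) / Real.pi - (if x < t then 1 else -1) / 2 - δ * x / (2 * Real.pi)|
      ≤ 3 := by
  have hp := Real.pi_gt_three
  have h1 : |sineSum N (δ * (t - x)) / Real.pi| ≤ 2 := by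
    rw [abs_div, abs_of_pos Real.pi_pos, div_le_iff₀ Real.pi_pos]
    linarith [abs_sineSum_le N (δ * (t - x))]
  have h2 : |δ * x / (2 * Real.pi)| ≤ 1 / 2 := by
    rw [le_div_iff₀ hδ] at hx
    rw [abs_div, abs_mul, abs_of_pos hδ, abs_of_pos (by positivity : 0 < 2 * Real.pi),
      div_le_iff₀ (by positivity)]
    linarith
  rw [abs_le] at h1 h2 ⊢
  split_ifs <;> constructor <;> linarith [h1.1, h1.2, h2.1, h2.2]

/-- With the exact sawtooth in place of `sineSum` the expression equals `-δ t / (2π)`, of size at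
most `δ M`. The hypothesis `hM` gives `δ |t - x| ≤ π + δ M ≤ 2π - δ η`, away from the next jump as
well. -/
theorem abs_sawtooth_error_le_of_le {δ x t η M : ℝ} {N : ℕ} (hδ : 0 < δ) (hN : 0 < N)
    (hη : 0 < η) (hM : δ * (M + η) ≤ Real.pi) (hx : |x| ≤ Real.pi / δ) (ht : |t| ≤ M)
    (htx : η ≤ |t - x|) :
    |sineSum N (δ * (t - x)) / Real.pi - (if x < t then 1 else -1) / 2 - δ * x / (2 * Real.pi)|
      ≤ δ * M + 1 / (N * δ * η) := by
  have hp := Real.pi_gt_three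
  have hN' : (0 : ℝ) < N := by exact_mod_cast hN
  have hx' : |δ * x| ≤ Real.pi := by
    rw [abs_mul, abs_of_pos hδ, mul_comm]
    exact (le_div_iff₀ hδ).1 hx
  have ht' : |δ * t| ≤ δ * M := by
    rw [abs_mul, abs_of_pos hδ]
    gcongr
  have hM0 : 0 ≤ δ * M := (abs_nonneg _).trans ht'
  have htail : |δ * t / (2 * Real.pi)| ≤ δ * M := by
    rw [abs_div, abs_of_pos (by positivity : 0 < 2 * Real.pi)]
    exact (div_le_self (abs_nonneg _) (by linarith)).trans ht'
  have hη' : 0 < δ * η := by positivity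
  have e : Real.pi / (N * (δ * η)) / Real.pi = 1 / (N * δ * η) := by
    field_simp
  rw [abs_le] at hx' ht'
  rcases lt_or_ge x t with h | h
  · rw [abs_of_pos (sub_pos.2 h)] at htx
    have := abs_sineSum_sub_le_of_lt_two_pi (u := δ * (t - x)) hN hη'
      (by gcongr) (by nlinarith)
    rw [← div_le_div_iff_of_pos_right Real.pi_pos, e, ← abs_of_pos Real.pi_pos, ← abs_div,
      abs_of_pos Real.pi_pos] at this
    rw [if_pos h]
    refine (le_of_eq ?_).trans ((abs_sub _ (δ * t / (2 * Real.pi))).trans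
      ((add_le_add this htail).trans (le_of_eq (add_comm _ _))))
    congr 1
    field_simp
    ring
  · rw [abs_of_nonpos (sub_nonpos.2 h), neg_sub] at htx
    have := abs_sineSum_sub_le_of_lt_two_pi (u := δ * (x - t)) hN hη'
      (by gcongr) (by nlinarith)
    rw [← div_le_div_iff_of_pos_right Real.pi_pos, e, ← abs_of_pos Real.pi_pos, ← abs_div,
      abs_of_pos Real.pi_pos, ← abs_neg] at this
    rw [if_neg (not_lt.2 h), show δ * (t - x) = -(δ * (x - t)) by ring, sineSum_neg]
    refine (le_of_eq ?_).trans ((abs_sub _ (δ * t / (2 * Real.pi))).trans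
      ((add_le_add this htail).trans (le_of_eq (add_comm _ _))))
    congr 1
    field_simp
    ring

/-- Quantitative form of the uniform convergence of the partial sums on the band. -/
theorem norm_partialSum_sub_le (hf : Integrable f) (hf' : Integrable f')
    (hd : ∀ a b : ℝ, f b - f a = ∫ x in a..b, f' x) {δ x η M : ℝ} {N : ℕ} (hδ : 0 < δ)
    (hN : 0 < N) (hη : 0 < η) (hM0 : 0 ≤ M) (hM : δ * (M + η) ≤ Real.pi) (hx : |x| ≤ Real.pi / δ) :
    ‖partialSum f δ N x - f x‖ ≤ δ * (∫ t, ‖f t‖) + 3 * (∫ t in (Icc (-M) M)ᶜ, ‖f' t‖) +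
      3 * (∫ t in Ioo (x - η) (x + η), ‖f' t‖) +
      (δ * M + 1 / (N * δ * η)) * ∫ t, ‖f' t‖ := by
  have hp := Real.pi_gt_three
  set k : ℝ → ℝ := fun t => sineSum N (δ * (t - x)) / Real.pi - (if x < t then 1 else -1) / 2 -
    δ * x / (2 * Real.pi) with hk
  have hm : Measurable fun t : ℝ => (if x < t then (1 : ℝ) else -1) :=
    Measurable.ite measurableSet_Ioi measurable_const measurable_const
  have hm1 : Measurable fun t => sineSum N (δ * (t - x)) / Real.pi :=
    ((continuous_sineSum N).comp (by fun_prop : Continuous fun t => δ * (t - x))).measurable.div_const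
      _
  have hi1 : Integrable fun t => ((sineSum N (δ * (t - x)) / Real.pi : ℝ) : ℂ) * f' t :=
    integrable_real_mul hf' hm1.aestronglyMeasurable (C := 6 / Real.pi) fun t => by
      rw [abs_div, abs_of_pos Real.pi_pos]
      gcongr
      exact abs_sineSum_le _ _
  have hi2 : Integrable fun t => ((if x < t then 1 else -1 : ℝ) : ℂ) * f' t :=
    integrable_real_mul hf' hm.aestronglyMeasurable (C := 1) fun t => by
      split_ifs <;> simp
  have hkm : Measurable k := (hm1.sub (hm.div_const 2)).sub measurable_const
  have e : partialSum f δ N x - f x = ((δ / (2 * Real.pi) : ℝ) : ℂ) * (∫ t, f t) -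
      ∫ t, (k t : ℂ) * f' t := by
    have e1 : ∫ t, (k t : ℂ) * f' t =
        (∫ t, ((sineSum N (δ * (t - x)) / Real.pi : ℝ) : ℂ) * f' t) -
        (∫ t, ((if x < t then 1 else -1 : ℝ) : ℂ) * f' t) * (1 / 2) -
        ((δ * x / (2 * Real.pi) : ℝ) : ℂ) * ∫ t, f' t := by
      rw [← integral_const_mul, ← integral_mul_const, ← integral_sub hi1 (hi2.mul_const _),
        ← integral_sub (by exact hi1.sub (hi2.mul_const _)) (hf'.const_mul _)]
      refine integral_congr_ae (ae_of_all _ fun t => ?_)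
      simp only [hk]
      rw [Complex.ofReal_sub, Complex.ofReal_sub, Complex.ofReal_div _ 2]
      push_cast
      ring
    rw [e1, partialSum_eq hf hf' hd hδ, integral_eq_zero_of_primitive hf hf' hd,
      integral_sign_mul_of_primitive hf hf' hd, mul_zero, sub_zero]
    linear_combination
  have hbound : ‖∫ t, (k t : ℂ) * f' t‖ ≤ 3 * (∫ t in (Icc (-M) M)ᶜ, ‖f' t‖) +
      3 * (∫ t in Ioo (x - η) (x + η), ‖f' t‖) +
      (δ * M + 1 / (N * δ * η)) * ∫ t, ‖f' t‖ := by
    have hI : Integrable fun t => 3 * (Icc (-M) M)ᶜ.indicator (fun t => ‖f' t‖) t +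
        3 * (Ioo (x - η) (x + η)).indicator (fun t => ‖f' t‖) t +
        (δ * M + 1 / (N * δ * η)) * ‖f' t‖ :=
      (((hf'.norm.indicator measurableSet_Icc.compl).const_mul 3).add
        ((hf'.norm.indicator measurableSet_Ioo).const_mul 3)).add (hf'.norm.const_mul _)
    refine (norm_integral_le_of_norm_le hI (ae_of_all _ fun t => ?_)).trans (le_of_eq ?_)
    · have h3 := abs_sawtooth_error_le (t := t) hδ N hx
      rw [norm_mul, Complex.norm_real, Real.norm_eq_abs]
      have i1 : 0 ≤ (Icc (-M) M)ᶜ.indicator (fun t => ‖f' t‖) t :=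
        indicator_nonneg (fun _ _ => norm_nonneg _) _
      have i2 : 0 ≤ (Ioo (x - η) (x + η)).indicator (fun t => ‖f' t‖) t :=
        indicator_nonneg (fun _ _ => norm_nonneg _) _
      have i3 : |k t| * ‖f' t‖ ≤ 3 * ‖f' t‖ := by gcongr
      have i4 : 0 ≤ (δ * M + 1 / (N * δ * η)) * ‖f' t‖ := by positivity
      -- Far out or close to `x` only the crude bound `3` holds; elsewhere the kernel itself is
      -- small.
      by_cases ht : t ∈ (Icc (-M) M)ᶜ
      · rw [indicator_of_mem ht] at i1 ⊢
        linarith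
      by_cases htx : t ∈ Ioo (x - η) (x + η)
      · rw [indicator_of_mem htx] at i2 ⊢
        linarith
      have h4 : |k t| * ‖f' t‖ ≤ (δ * M + 1 / (N * δ * η)) * ‖f' t‖ := by
        gcongr
        refine abs_sawtooth_error_le_of_le hδ hN hη hM hx (abs_le.2 (notMem_compl_iff.1 ht)) ?_
        by_contra! h
        rw [abs_lt] at h
        exact htx ⟨by linarith [h.1], by linarith [h.2]⟩
      linarith
    · rw [integral_add, integral_add, integral_const_mul, integral_const_mul, integral_const_mul,
        integral_indicator measurableSet_Icc.compl, integral_indicator measurableSet_Ioo]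
      · exact (hf'.norm.indicator measurableSet_Icc.compl).const_mul 3
      · exact (hf'.norm.indicator measurableSet_Ioo).const_mul 3
      · exact ((hf'.norm.indicator measurableSet_Icc.compl).const_mul 3).add
          ((hf'.norm.indicator measurableSet_Ioo).const_mul 3)
      · exact hf'.norm.const_mul _
  rw [e, add_assoc, add_assoc]
  refine (norm_sub_le _ _).trans (add_le_add ?_ (by rwa [← add_assoc]))
  rw [norm_mul, Complex.norm_real, Real.norm_of_nonneg (by positivity)]
  refine mul_le_mul ?_ (norm_integral_le_integral_norm _) (norm_nonneg _) hδ.le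
  exact div_le_self hδ.le (by linarith)

end Primitive

/-! ### Small tails and small intervals -/

theorem tendsto_integral_compl_Icc {g : ℝ → ℝ} (hg : Integrable g) :
    Tendsto (fun M : ℝ => ∫ t in (Icc (-M) M)ᶜ, g t) atTop (𝓝 0) := by
  have h := (aecover_Icc (μ := volume) tendsto_neg_atTop_atBot
    tendsto_id).integral_tendsto_of_countably_generated hg
  have h2 := h.const_sub (∫ t, g t)
  rw [sub_self] at h2
  refine h2.congr fun M => ?_
  rw [← integral_add_compl (measurableSet_Icc (a := -M) (b := M)) hg]
  simp

/-- Absolute continuity of the integral sees only the length of the interval, so `η` is uniform in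
`x`. -/
theorem exists_forall_integral_Ioo_le {g : ℝ → ℝ} (hg : Integrable g) (h0 : ∀ t, 0 ≤ g t) {ε : ℝ}
    (hε : 0 < ε) : ∃ η > 0, ∀ x, ∫ t in Ioo (x - η) (x + η), g t ≤ ε := by
  have hfin : ∫⁻ t, ENNReal.ofReal (g t) ≠ ⊤ := by
    have := hg.hasFiniteIntegral
    rw [hasFiniteIntegral_iff_ofReal (ae_of_all _ h0)] at this
    exact this.ne
  obtain ⟨c, hc, h⟩ := exists_pos_setLIntegral_lt_of_measure_lt hfin
    (ENNReal.ofReal_pos.2 hε).ne'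
  obtain ⟨η, hη, hηc⟩ := ENNReal.lt_iff_exists_real_btwn.1 hc
  rcases hηc with ⟨h1, h2⟩
  have hη0 : 0 < η := ENNReal.ofReal_pos.1 h1
  refine ⟨η / 2, by positivity, fun x => ?_⟩
  rw [integral_eq_lintegral_of_nonneg_ae (ae_of_all _ h0) hg.aestronglyMeasurable.restrict]
  refine ENNReal.toReal_le_of_le_ofReal hε.le (h _ ?_).le
  rwa [Real.volume_Ioo, show x + η / 2 - (x - η / 2) = η by ring]

/-! ### Orthogonality and Parseval's identity -/

theorem integral_exp_int_mul {δ : ℝ} (hδ : 0 < δ) (k : ℤ) :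
    ∫ x in (-(Real.pi / δ))..(Real.pi / δ), Complex.exp (Complex.I * ((x * (k * δ) : ℝ) : ℂ)) =
      if k = 0 then ((2 * Real.pi / δ : ℝ) : ℂ) else 0 := by
  split_ifs with hk
  · simp only [hk, Int.cast_zero, zero_mul, mul_zero, Complex.ofReal_zero, Complex.exp_zero,
      intervalIntegral.integral_const, Complex.real_smul, mul_one]
    congr 1
    ring
  · have hδ' : (δ : ℂ) ≠ 0 := by exact_mod_cast hδ.ne'
    have hc : Complex.I * (k * δ) ≠ 0 :=
      mul_ne_zero Complex.I_ne_zero (mul_ne_zero (by exact_mod_cast hk) hδ')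
    have e : ∀ x : ℝ, Complex.exp (Complex.I * ((x * (k * δ) : ℝ) : ℂ)) =
        Complex.exp (Complex.I * (k * δ) * x) := fun s => by push_cast; ring_nf
    simp_rw [e]
    rw [integral_exp_mul_complex hc, div_eq_zero_iff]
    left
    rw [sub_eq_zero, Complex.exp_eq_exp_iff_exists_int]
    refine ⟨k, ?_⟩
    push_cast
    field_simp
    ring

/-- Orthogonality: the Fourier coefficients of the partial sum. -/
theorem integral_partialSum_mul_exp (f : ℝ → ℂ) {δ : ℝ} (hδ : 0 < δ) {N : ℕ} {m : ℤ}
    (hm : m ∈ Finset.Icc (-(N : ℤ)) (N : ℤ)) :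
    ∫ x in (-(Real.pi / δ))..(Real.pi / δ), partialSum f δ N x *
      Complex.exp (Complex.I * ((x * (m * δ) : ℝ) : ℂ)) = fourierT f (m * δ) := by
  have hp : (Real.pi : ℂ) ≠ 0 := by exact_mod_cast Real.pi_ne_zero
  have hδ' : (δ : ℂ) ≠ 0 := by exact_mod_cast hδ.ne'
  have e : ∀ x : ℝ, partialSum f δ N x * Complex.exp (Complex.I * ((x * (m * δ) : ℝ) : ℂ)) =
      ∑ n ∈ Finset.Icc (-(N : ℤ)) (N : ℤ), (((δ / (2 * Real.pi) : ℝ) : ℂ) * fourierT f (n * δ)) *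
        Complex.exp (Complex.I * ((x * ((m - n : ℤ) * δ) : ℝ) : ℂ)) := by
    intro x
    unfold partialSum
    rw [mul_assoc, Finset.sum_mul, Finset.mul_sum]
    refine Finset.sum_congr rfl fun n _ => ?_
    rw [mul_assoc (fourierT _ _), ← Complex.exp_add, mul_assoc]
    congr 3
    push_cast
    ring
  simp_rw [e]
  rw [intervalIntegral.integral_finsetSum
    (fun n _ => Continuous.intervalIntegrable (by fun_prop) _ _)]
  simp_rw [intervalIntegral.integral_const_mul, integral_exp_int_mul hδ, sub_eq_zero]
  rw [Finset.sum_eq_single m (fun n _ hn => by rw [if_neg hn.symm, mul_zero])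
    (fun h => absurd hm h), if_pos rfl]
  push_cast
  field_simp

theorem conj_cexp_I_mul (x : ℝ) : (starRingEnd ℂ) (Complex.exp (Complex.I * (x : ℂ))) =
    Complex.exp (Complex.I * ((-x : ℝ) : ℂ)) := by
  rw [← Complex.exp_conj]
  congr 1
  simp

theorem conj_partialSum (f : ℝ → ℂ) (δ : ℝ) (N : ℕ) (x : ℝ) :
    (starRingEnd ℂ) (partialSum f δ N x) = ((δ / (2 * Real.pi) : ℝ) : ℂ) *
      ∑ n ∈ Finset.Icc (-(N : ℤ)) (N : ℤ), (starRingEnd ℂ) (fourierT f (n * δ)) *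
        Complex.exp (Complex.I * ((x * (n * δ) : ℝ) : ℂ)) := by
  unfold partialSum
  simp only [map_mul, map_sum, Complex.conj_ofReal, conj_cexp_I_mul, neg_neg]

/-- Parseval's identity in the form: integrating the partial sum against its conjugate over a
period is the same as integrating `f` against it over the real line. -/
theorem integral_partialSum_mul_conj {f : ℝ → ℂ} (hf : Integrable f) {δ : ℝ} (hδ : 0 < δ) (N : ℕ) :
    ∫ x in (-(Real.pi / δ))..(Real.pi / δ), partialSum f δ N x *
      (starRingEnd ℂ) (partialSum f δ N x) =
      ∫ x, f x * (starRingEnd ℂ) (partialSum f δ N x) := by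
  have e : ∀ (g : ℝ → ℂ) (x : ℝ), g x * (starRingEnd ℂ) (partialSum f δ N x) =
      ∑ n ∈ Finset.Icc (-(N : ℤ)) (N : ℤ),
        (((δ / (2 * Real.pi) : ℝ) : ℂ) * (starRingEnd ℂ) (fourierT f (n * δ))) *
        (g x * Complex.exp (Complex.I * ((x * (n * δ) : ℝ) : ℂ))) := by
    intro g x
    rw [conj_partialSum, Finset.mul_sum, Finset.mul_sum]
    refine Finset.sum_congr rfl fun n _ => ?_
    ring
  have hS := continuous_partialSum f δ N
  have hi : ∀ y : ℝ, Integrable fun x : ℝ => f x * Complex.exp (Complex.I * ((x * y : ℝ) : ℂ)) :=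
    fun y => by simpa only [mul_comm] using integrable_cexp_mul hf y
  simp_rw [e f, e (partialSum f δ N)]
  rw [intervalIntegral.integral_finsetSum
    (fun n _ => Continuous.intervalIntegrable (by fun_prop) _ _),
    integral_finsetSum _ (fun n _ => (hi _).const_mul _)]
  -- For each `n` both integrals equal `fourierT f (n * δ)`: over the period by orthogonality, over
  -- the line by definition.
  refine Finset.sum_congr rfl fun n hn => ?_
  rw [intervalIntegral.integral_const_mul, integral_const_mul, integral_partialSum_mul_exp f hδ hn]
  congr 1
  unfold fourierT
  simp_rw [mul_comm]

/-! ### Uniform and mean square convergence of the truncated sums -/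

/-- The inverse Fourier transform of the interpolant. -/
noncomputable def truncated (f : ℝ → ℂ) (δ : ℝ) (N : ℕ) : ℝ → ℂ :=
  (Ioc (-(Real.pi / δ)) (Real.pi / δ)).indicator (partialSum f δ N)

theorem integrable_truncated (f : ℝ → ℂ) (δ : ℝ) (N : ℕ) : Integrable (truncated f δ N) :=
  ((continuous_partialSum f δ N).integrableOn_Icc.mono_set Ioc_subset_Icc_self).integrable_indicator
    measurableSet_Ioc

section Primitive

variable {f f' : ℝ → ℂ}

/-- Uniform convergence of the partial sums on the band. -/
theorem exists_forall_norm_partialSum_sub_le (hf : Integrable f) (hf' : Integrable f')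
    (hd : ∀ a b : ℝ, f b - f a = ∫ x in a..b, f' x) {ε : ℝ} (hε : 0 < ε) :
    ∃ δ₀ > 0, ∃ R₀ > 0, ∀ (δ : ℝ) (N : ℕ), 0 < δ → δ < δ₀ → R₀ < N * δ → ∀ x, |x| ≤ Real.pi / δ →
      ‖partialSum f δ N x - f x‖ ≤ ε := by
  obtain ⟨η, hη, hηx⟩ := exists_forall_integral_Ioo_le hf'.norm (fun _ => norm_nonneg _)
    (show 0 < ε / 15 by positivity)
  obtain ⟨M, hM, hM0⟩ := (((tendsto_integral_compl_Icc hf'.norm).eventually_le_const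
    (show 0 < ε / 15 by positivity)).and (eventually_ge_atTop 0)).exists
  set A := ∫ t, ‖f t‖ with hA
  set B := ∫ t, ‖f' t‖ with hB
  have hA0 : 0 ≤ A := integral_nonneg fun _ => norm_nonneg _
  have hB0 : 0 ≤ B := integral_nonneg fun _ => norm_nonneg _
  have hp := Real.pi_gt_three
  -- The first bound on `δ` ensures `δ (M + η) ≤ π`, the second `δ (A + M B) ≤ ε / 5`; `R₀` makes `B
  -- / (N δ η) ≤ ε / 5`. The two masses of `|f'|` cost `3 · ε / 15` each.
  refine ⟨min (Real.pi / (M + η)) (ε / (5 * (A + M * B + 1))), by positivity,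
    5 * (B + 1) / (ε * η), by positivity, fun δ N hδ hδ0 hR x hx => ?_⟩
  have hN : 0 < N := by
    by_contra! h
    have : N = 0 := by omega
    rw [this, Nat.cast_zero, zero_mul] at hR
    exact absurd hR (not_lt.2 (by positivity))
  have hN' : (0 : ℝ) < N := by exact_mod_cast hN
  have h1 := hδ0.le.trans (min_le_left _ _)
  have h2 := hδ0.le.trans (min_le_right _ _)
  rw [le_div_iff₀ (by positivity)] at h1 h2
  refine (norm_partialSum_sub_le hf hf' hd hδ hN hη hM0 h1 hx).trans ?_
  have h3 : 1 / (N * δ * η) * B ≤ ε / 5 := by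
    rw [div_lt_iff₀ (by positivity)] at hR
    rw [one_div, inv_mul_le_iff₀ (by positivity)]
    nlinarith
  have h4 := hηx x
  have h5 : 0 ≤ δ * M * B := by positivity
  have h6 : 0 ≤ δ * A := by positivity
  rw [add_mul]
  nlinarith

/-- Outside the band the error is `|f|`, which is small there once `π / δ` is large. -/
theorem exists_forall_norm_truncated_sub_le (hf : Integrable f) (hf' : Integrable f')
    (hd : ∀ a b : ℝ, f b - f a = ∫ x in a..b, f' x) {ε : ℝ} (hε : 0 < ε) :
    ∃ δ₀ > 0, ∃ R₀ > 0, ∀ (δ : ℝ) (N : ℕ), 0 < δ → δ < δ₀ → R₀ < N * δ → ∀ x,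
      ‖truncated f δ N x - f x‖ ≤ ε := by
  obtain ⟨δ₀, hδ₀, R₀, hR₀, h⟩ := exists_forall_norm_partialSum_sub_le hf hf' hd hε
  obtain ⟨a, ha⟩ := eventually_atTop.1
    ((tendsto_atTop_zero_of_primitive hf hf' hd).norm.eventually_le_const (by simpa using hε))
  obtain ⟨b, hb⟩ := eventually_atBot.1
    ((tendsto_atBot_zero_of_primitive hf hf' hd).norm.eventually_le_const (by simpa using hε))
  have hc : 0 < |a| + |b| + 1 := by positivity
  refine ⟨min δ₀ (Real.pi / (|a| + |b| + 1)), lt_min hδ₀ (div_pos Real.pi_pos hc), R₀, hR₀,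
    fun δ N hδ hδ0 hR x => ?_⟩
  unfold truncated
  by_cases hx : x ∈ Ioc (-(Real.pi / δ)) (Real.pi / δ)
  · rw [indicator_of_mem hx]
    exact h δ N hδ (hδ0.trans_le (min_le_left _ _)) hR x (abs_le.2 ⟨hx.1.le, hx.2⟩)
  · rw [indicator_of_notMem hx, zero_sub, norm_neg]
    have h1 := hδ0.le.trans (min_le_right _ _)
    rw [le_div_comm₀ hδ hc] at h1
    rw [mem_Ioc, not_and_or, not_lt, not_le] at hx
    rcases hx with hx | hx
    · exact hb x (by linarith [neg_abs_le b, abs_nonneg a])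
    · exact ha x (by linarith [le_abs_self a, abs_nonneg b])

/-- On the band, `|S - f|² = Re (S conj S - f conj S) + Re (f conj (f - S))`. By Parseval the first
part, extended by `-Re (f conj S)` off the band, integrates to zero; the second is at most `ε |f|`.
-/
theorem integral_norm_truncated_sub_sq_le (hf : Integrable f)
    (hf' : Integrable f')
    (hd : ∀ a b : ℝ, f b - f a = ∫ x in a..b, f' x) {δ ε : ℝ} (hδ : 0 < δ) (N : ℕ)
    (h : ∀ x, ‖truncated f δ N x - f x‖ ≤ ε) :
    ∫ x, ‖truncated f δ N x - f x‖ ^ 2 ≤ ε * (∫ t, ‖f t‖) +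
      (δ * (∫ t, ‖f t‖) + 3 * ∫ t, ‖f' t‖) *
        ∫ t in (Icc (-(Real.pi / δ)) (Real.pi / δ))ᶜ, ‖f t‖ := by
  set L := Real.pi / δ with hL
  set K := δ * (∫ t, ‖f t‖) + 3 * ∫ t, ‖f' t‖ with hK
  set S := partialSum f δ N with hS
  set I := Ioc (-L) L with hI
  have hB0 : 0 ≤ ∫ t, ‖f' t‖ := integral_nonneg fun _ => norm_nonneg _
  have hA0 : 0 ≤ ∫ t, ‖f t‖ := integral_nonneg fun _ => norm_nonneg _
  have hSc : Continuous S := continuous_partialSum f δ N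
  have hSK : ∀ x, ‖S x‖ ≤ δ * (∫ t, ‖f t‖) + 2 * ∫ t, ‖f' t‖ := norm_partialSum_le hf hf' hd hδ N
  have hε : 0 ≤ ε := (norm_nonneg _).trans (h 0)
  have hLpos : 0 ≤ L := by positivity
  have hC : Integrable fun x => f x * (starRingEnd ℂ) (S x) :=
    hf.mul_bdd (Continuous.aestronglyMeasurable (by fun_prop))
      (ae_of_all _ fun x => by simpa using hSK x)
  have hP : Integrable (I.indicator fun x => S x * (starRingEnd ℂ) (S x)) :=
    ((Continuous.integrableOn_Icc (by fun_prop)).mono_set Ioc_subset_Icc_self).integrable_indicator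
      measurableSet_Ioc
  have hPar : ∫ x, (I.indicator (fun x => S x * (starRingEnd ℂ) (S x)) x -
      f x * (starRingEnd ℂ) (S x)).re = 0 := by
    have e := integral_partialSum_mul_conj hf hδ N
    rw [intervalIntegral.integral_of_le (by linarith), ← integral_indicator measurableSet_Ioc] at e
    have e2 := integral_re (hP.sub hC)
    simp only [Pi.sub_apply] at e2
    rw [integral_sub hP hC, e, sub_self] at e2
    simpa using e2
  have hR : Integrable fun x => (I.indicator (fun x => S x * (starRingEnd ℂ) (S x)) x -
      f x * (starRingEnd ℂ) (S x)).re := (hP.sub hC).re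
  have hT : Integrable fun x => ε * ‖f x‖ + Iᶜ.indicator (fun x => K * ‖f x‖) x :=
    (hf.norm.const_mul ε).add ((hf.norm.const_mul K).indicator measurableSet_Ioc.compl)
  calc ∫ x, ‖truncated f δ N x - f x‖ ^ 2
      ≤ ∫ x, ((I.indicator (fun x => S x * (starRingEnd ℂ) (S x)) x -
          f x * (starRingEnd ℂ) (S x)).re +
          (ε * ‖f x‖ + Iᶜ.indicator (fun x => K * ‖f x‖) x)) := by
        refine integral_mono_of_nonneg (ae_of_all _ fun x => by positivity) (hR.add hT)
          (ae_of_all _ fun x => ?_)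
        have hx := h x
        simp only [truncated, ← hL, ← hI, ← hS] at hx ⊢
        by_cases hxI : x ∈ I
        · rw [indicator_of_mem hxI] at hx
          rw [indicator_of_mem hxI, indicator_of_mem hxI,
            indicator_of_notMem (notMem_compl_iff.2 hxI), add_zero]
          have e : ‖S x - f x‖ ^ 2 = (S x * (starRingEnd ℂ) (S x) -
              f x * (starRingEnd ℂ) (S x)).re + (f x * (starRingEnd ℂ) (f x - S x)).re := by
            rw [← Complex.normSq_eq_norm_sq, Complex.normSq_apply]
            simp
            ring
          rw [e]
          gcongr
          refine (Complex.re_le_norm _).trans ?_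
          rw [norm_mul, RCLike.norm_conj, norm_sub_rev, mul_comm]
          gcongr
        · rw [indicator_of_notMem hxI, indicator_of_notMem hxI,
            indicator_of_mem (mem_compl hxI), zero_sub, zero_sub, norm_neg]
          -- Off the band `|f|² + Re (f conj S)` must be absorbed: `|S| ≤ δ ‖f‖₁ + 2 ‖f'‖₁` and `|f|
          -- ≤ ‖f'‖₁` add up to `K`.
          have e1 : (f x * (starRingEnd ℂ) (S x)).re ≤
              ‖f x‖ * (δ * (∫ t, ‖f t‖) + 2 * ∫ t, ‖f' t‖) := by
            refine (Complex.re_le_norm _).trans ?_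
            rw [norm_mul, RCLike.norm_conj]
            gcongr
            exact hSK x
          have e2 := mul_le_mul_of_nonneg_left (norm_le_of_primitive hf hf' hd x)
            (norm_nonneg (f x))
          have e3 : 0 ≤ ε * ‖f x‖ := by positivity
          rw [Complex.neg_re, hK]
          nlinarith
    _ = ε * (∫ t, ‖f t‖) + K * ∫ t in (Icc (-L) L)ᶜ, ‖f t‖ := by
        rw [integral_add hR hT, hPar, zero_add, integral_add (hf.norm.const_mul ε)
          ((hf.norm.const_mul K).indicator measurableSet_Ioc.compl), integral_const_mul,
          integral_indicator measurableSet_Ioc.compl, integral_const_mul]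
        congr 2
        exact setIntegral_congr_set (Ioc_ae_eq_Icc.compl)

/-- Convergence in mean square of the truncated partial sums. -/
theorem exists_forall_integral_norm_truncated_sub_sq_le (hf : Integrable f)
    (hf' : Integrable f')
    (hd : ∀ a b : ℝ, f b - f a = ∫ x in a..b, f' x) {ε : ℝ} (hε : 0 < ε) :
    ∃ δ₀ > 0, ∃ R₀ > 0, ∀ (δ : ℝ) (N : ℕ), 0 < δ → δ < δ₀ → R₀ < N * δ →
      ∫ x, ‖truncated f δ N x - f x‖ ^ 2 ≤ ε := by
  set A := ∫ t, ‖f t‖ with hA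
  set B := ∫ t, ‖f' t‖ with hB
  have hA0 : 0 ≤ A := integral_nonneg fun _ => norm_nonneg _
  have hB0 : 0 ≤ B := integral_nonneg fun _ => norm_nonneg _
  obtain ⟨δ₀, hδ₀, R₀, hR₀, h⟩ := exists_forall_norm_truncated_sub_le hf hf' hd
    (show 0 < ε / (2 * (A + 1)) by positivity)
  obtain ⟨M, hM⟩ := eventually_atTop.1 ((tendsto_integral_compl_Icc hf.norm).eventually_le_const
    (show 0 < ε / (2 * (A + 3 * B + 1)) by positivity))
  refine ⟨min (min δ₀ 1) (Real.pi / (|M| + 1)), by positivity, R₀, hR₀,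
    fun δ N hδ hδ0 hR => ?_⟩
  have h0 := hδ0.trans_le ((min_le_left _ _).trans (min_le_left _ _))
  have h1 := hδ0.le.trans ((min_le_left _ _).trans (min_le_right _ _))
  have h2 := hδ0.le.trans (min_le_right _ _)
  rw [le_div_comm₀ hδ (by positivity)] at h2
  refine (integral_norm_truncated_sub_sq_le hf hf' hd hδ N (h δ N hδ h0 hR)).trans ?_
  have h3 := hM (Real.pi / δ) (by linarith [le_abs_self M])
  have h4 : ε / (2 * (A + 1)) * A ≤ ε / 2 := by
    rw [div_mul_eq_mul_div, div_le_div_iff₀ (by positivity) (by positivity)]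
    nlinarith
  have h5 : (δ * A + 3 * B) * ∫ t in (Icc (-(Real.pi / δ)) (Real.pi / δ))ᶜ, ‖f t‖ ≤
      (A + 3 * B + 1) * (ε / (2 * (A + 3 * B + 1))) := by
    refine mul_le_mul ?_ h3 (integral_nonneg fun _ => norm_nonneg _) (by positivity)
    nlinarith
  have h6 : (A + 3 * B + 1) * (ε / (2 * (A + 3 * B + 1))) = ε / 2 := by
    field_simp
  linarith

end Primitive

/-! ### Convolution with a probability density -/

/-- The convolution of a real kernel with a complex function. -/
noncomputable def mollify (k : ℝ → ℝ) (g : ℝ → ℂ) (x : ℝ) : ℂ :=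
  ∫ t, (k t : ℂ) * g (x - t)

section Kernel

variable {k : ℝ → ℝ} {g h : ℝ → ℂ}

theorem integrable_mul_comp_sub (hk : Integrable k) (hg : Integrable g) {C : ℝ}
    (hC : ∀ x, ‖g x‖ ≤ C) (x : ℝ) : Integrable fun t => (k t : ℂ) * g (x - t) :=
  hk.ofReal.mul_bdd (hg.comp_sub_left x).aestronglyMeasurable (ae_of_all _ fun _ => hC _)

theorem integrable_mul_norm_comp_sub (hk : Integrable k) (hg : Integrable g) {C : ℝ}
    (hC : ∀ x, ‖g x‖ ≤ C) (x : ℝ) : Integrable fun t => k t * ‖g (x - t)‖ :=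
  hk.mul_bdd (c := C) (hg.comp_sub_left x).norm.aestronglyMeasurable
    (ae_of_all _ fun _ => by simpa using hC _)

theorem integrable_norm_sq (hg : Integrable g) {C : ℝ} (hC : ∀ x, ‖g x‖ ≤ C) :
    Integrable fun x => ‖g x‖ ^ 2 := by
  simp_rw [pow_two]
  exact hg.norm.mul_bdd (c := C) hg.norm.aestronglyMeasurable
    (ae_of_all _ fun _ => by simpa using hC _)

theorem mollify_sub (hk : Integrable k) (hg : Integrable g) (hh : Integrable h) {C D : ℝ}
    (hC : ∀ x, ‖g x‖ ≤ C) (hD : ∀ x, ‖h x‖ ≤ D) (x : ℝ) :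
    mollify k (fun x => g x - h x) x = mollify k g x - mollify k h x := by
  unfold mollify
  rw [← integral_sub (integrable_mul_comp_sub hk hg hC x) (integrable_mul_comp_sub hk hh hD x)]
  simp_rw [mul_sub]

theorem norm_mollify_le (h0 : ∀ t, 0 ≤ k t) (x : ℝ) :
    ‖mollify k g x‖ ≤ ∫ t, k t * ‖g (x - t)‖ := by
  refine (norm_integral_le_integral_norm _).trans (le_of_eq ?_)
  simp_rw [norm_mul, Complex.norm_real, Real.norm_of_nonneg (h0 _)]

theorem norm_mollify_le_of_norm_le (h0 : ∀ t, 0 ≤ k t) (hk : Integrable k) (h1 : ∫ t, k t = 1)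
    {C : ℝ} (hC : ∀ x, ‖g x‖ ≤ C) (x : ℝ) : ‖mollify k g x‖ ≤ C := by
  refine (norm_integral_le_of_norm_le (hk.mul_const C) (ae_of_all _ fun t => ?_)).trans
    (le_of_eq ?_)
  · rw [norm_mul, Complex.norm_real, Real.norm_of_nonneg (h0 _)]
    exact mul_le_mul_of_nonneg_left (hC _) (h0 t)
  · rw [integral_mul_const, h1, one_mul]

theorem mollify_eq_convolution (k : ℝ → ℝ) (g : ℝ → ℂ) :
    mollify k g = convolution (fun t => (k t : ℂ)) g (ContinuousLinearMap.mul ℂ ℂ) volume := rfl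

theorem integrable_mollify (hk : Integrable k) (hg : Integrable g) : Integrable (mollify k g) := by
  rw [mollify_eq_convolution]
  exact hk.ofReal.integrable_convolution _ hg

theorem integrable_integral_mul_comp_sub (hk : Integrable k) {u : ℝ → ℝ} (hu : Integrable u) :
    Integrable fun x => ∫ t, k t * u (x - t) :=
  hk.integrable_convolution (ContinuousLinearMap.mul ℝ ℝ) hu

theorem integral_integral_mul_comp_sub (hk : Integrable k) (h1 : ∫ t, k t = 1) {u : ℝ → ℝ}
    (hu : Integrable u) : ∫ x, ∫ t, k t * u (x - t) = ∫ x, u x := by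
  have := integral_convolution (ContinuousLinearMap.mul ℝ ℝ) hk hu
  rwa [ContinuousLinearMap.mul_apply', h1, one_mul] at this

theorem integral_norm_mollify_le (h0 : ∀ t, 0 ≤ k t) (hk : Integrable k) (h1 : ∫ t, k t = 1)
    (hg : Integrable g) : ∫ x, ‖mollify k g x‖ ≤ ∫ x, ‖g x‖ := by
  rw [← integral_integral_mul_comp_sub hk h1 hg.norm]
  exact integral_mono (integrable_mollify hk hg).norm (integrable_integral_mul_comp_sub hk hg.norm)
    fun x => norm_mollify_le h0 x

/-- Jensen's inequality for the probability density `k`, from nonnegativity of the variance of `‖g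
(x - t)‖`. -/
theorem norm_mollify_sq_le (h0 : ∀ t, 0 ≤ k t) (hk : Integrable k) (h1 : ∫ t, k t = 1)
    (hg : Integrable g) {C : ℝ} (hC : ∀ x, ‖g x‖ ≤ C) (x : ℝ) :
    ‖mollify k g x‖ ^ 2 ≤ ∫ t, k t * ‖g (x - t)‖ ^ 2 := by
  set a := ∫ t, k t * ‖g (x - t)‖ with ha
  have i1 := integrable_mul_norm_comp_sub hk hg hC x
  have i2 : Integrable fun t => k t * ‖g (x - t)‖ ^ 2 := by
    refine hk.mul_bdd (c := C ^ 2) ((hg.comp_sub_left x).norm.aestronglyMeasurable.pow 2)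
      (ae_of_all _ fun t => ?_)
    rw [Real.norm_of_nonneg (by positivity)]
    gcongr
    exact hC _
  have key : 0 ≤ ∫ t, k t * (‖g (x - t)‖ - a) ^ 2 :=
    integral_nonneg fun t => mul_nonneg (h0 t) (sq_nonneg _)
  have e : ∫ t, k t * (‖g (x - t)‖ - a) ^ 2 = (∫ t, k t * ‖g (x - t)‖ ^ 2) - a ^ 2 := by
    have : ∀ t, k t * (‖g (x - t)‖ - a) ^ 2 =
        k t * ‖g (x - t)‖ ^ 2 - (2 * a) * (k t * ‖g (x - t)‖) + a ^ 2 * k t := fun t => by ring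
    simp_rw [this]
    rw [integral_add (by exact i2.sub (i1.const_mul _)) (hk.const_mul _),
      integral_sub i2 (i1.const_mul _), integral_const_mul, integral_const_mul, h1, ← ha]
    ring
  have hle : ‖mollify k g x‖ ^ 2 ≤ a ^ 2 := by
    gcongr
    exact norm_mollify_le h0 x
  linarith

/-- Convolution with a probability density is a contraction in mean square. -/
theorem integral_norm_mollify_sq_le (h0 : ∀ t, 0 ≤ k t) (hk : Integrable k) (h1 : ∫ t, k t = 1)
    (hg : Integrable g) {C : ℝ} (hC : ∀ x, ‖g x‖ ≤ C) :
    ∫ x, ‖mollify k g x‖ ^ 2 ≤ ∫ x, ‖g x‖ ^ 2 := by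
  have hg2 := integrable_norm_sq hg hC
  rw [← integral_integral_mul_comp_sub hk h1 hg2]
  exact integral_mono_of_nonneg (ae_of_all _ fun x => by positivity)
    (integrable_integral_mul_comp_sub hk hg2)
    (ae_of_all _ fun x => norm_mollify_sq_le h0 hk h1 hg hC x)

/-- The convolution of an integrable kernel with a bounded function that is continuous outside
a countable set is continuous. -/
theorem continuous_mollify (hk : Integrable k) (hg : Integrable g) {C : ℝ}
    (hC : ∀ x, ‖g x‖ ≤ C) {s : Set ℝ} (hs : s.Countable) (hgs : ∀ x ∉ s, ContinuousAt g x) :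
    Continuous (mollify k g) := by
  rw [continuous_iff_continuousAt]
  intro x₀
  refine continuousAt_of_dominated (bound := fun t => ‖k t‖ * C)
    (Eventually.of_forall fun x => (integrable_mul_comp_sub hk hg hC x).aestronglyMeasurable)
    (Eventually.of_forall fun x => ae_of_all _ fun t => ?_) (hk.norm.mul_const C) ?_
  · rw [norm_mul, Complex.norm_real]
    exact mul_le_mul_of_nonneg_left (hC _) (norm_nonneg _)
  · have hs' : ((fun t => x₀ - t) '' s).Countable := hs.image _
    filter_upwards [hs'.ae_notMem volume] with t ht
    refine continuousAt_const.mul ?_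
    have : x₀ - t ∉ s := fun h => ht ⟨x₀ - t, h, by simp⟩
    exact ContinuousAt.comp (f := fun x => x - t) (hgs _ this) (by fun_prop)

end Kernel

/-! ### Approximation by mollifiers -/

section Mollifier

variable {e : ℝ → ℝ → ℝ}

/-- Mollification of a bounded uniformly continuous function converges uniformly. -/
theorem IsMollifier.eventually_norm_mollify_sub_le (he : IsMollifier e) {f : ℝ → ℂ}
    (hf : Integrable f) (huc : UniformContinuous f) {C : ℝ} (hC : ∀ x, ‖f x‖ ≤ C)
    {ε : ℝ} (hε : 0 < ε) :
    ∀ᶠ γ in 𝓝[>] (0 : ℝ), ∀ x, ‖mollify (e γ) f x - f x‖ ≤ ε := by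
  obtain ⟨η, hη, hηf⟩ := Metric.uniformContinuous_iff.1 huc (ε / 2) (by positivity)
  have hC0 : 0 ≤ C := (norm_nonneg _).trans (hC 0)
  -- Testing the delta convergence on a bump `φ` with `φ 0 = 1`, vanishing at distance at least `η`,
  -- shows that `∫ e_γ (1 - φ)` is small: the mass of `e_γ` concentrates near `0`.
  let φ : ContDiffBump (0 : ℝ) := ⟨η / 2, η, by positivity, by linarith⟩
  have hφ := he.tendsto_dirac φ φ.contDiff φ.hasCompactSupport
  rw [show φ 0 = 1 from φ.one_of_mem_closedBall (Metric.mem_closedBall_self φ.rIn_pos.le)] at hφ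
  have h1 : (1 : ℝ) - ε / (4 * (C + 1)) < 1 := by
    have : 0 < ε / (4 * (C + 1)) := by positivity
    linarith
  filter_upwards [hφ.eventually_const_le h1, self_mem_nhdsWithin] with γ hγ hγ0 x
  have hk := he.integrable γ hγ0
  have hk0 := he.nonneg γ hγ0
  have hkφ : Integrable fun t => e γ t * φ t :=
    hk.mul_bdd (c := 1) φ.continuous.aestronglyMeasurable
      (ae_of_all _ fun t => by rw [Real.norm_of_nonneg φ.nonneg]; exact φ.le_one)
  have e1 : mollify (e γ) f x - f x = ∫ t, (e γ t : ℂ) * (f (x - t) - f x) := by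
    have hkc : Integrable fun t => (e γ t : ℂ) := hk.ofReal
    simp_rw [mul_sub]
    rw [integral_sub (integrable_mul_comp_sub hk hf hC x) (hkc.mul_const _),
      integral_mul_const, integral_complex_ofReal, he.integral_eq_one γ hγ0]
    simp [mollify]
  rw [e1]
  have hI : Integrable fun t => (ε / 2 + 2 * C) * e γ t - 2 * C * (e γ t * φ t) :=
    (hk.const_mul _).sub (hkφ.const_mul _)
  refine (norm_integral_le_of_norm_le hI (ae_of_all _ fun t => ?_)).trans ?_
  · rw [norm_mul, Complex.norm_real, Real.norm_of_nonneg (hk0 t)]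
    have hle : ‖f (x - t) - f x‖ ≤ ε / 2 + 2 * C * (1 - φ t) := by
      have hφ1 : 0 ≤ 2 * C * (1 - φ t) := mul_nonneg (by positivity) (sub_nonneg.2 φ.le_one)
      rcases lt_or_ge (dist (x - t) x) η with h | h
      · have := hηf h
        rw [dist_eq_norm] at this
        linarith
      · have ht : φ t = 0 := φ.zero_of_le_dist (by simpa [dist_eq_norm] using h)
        rw [ht]
        have := norm_sub_le (f (x - t)) (f x)
        linarith [hC (x - t), hC x]
    have := mul_le_mul_of_nonneg_left hle (hk0 t)
    linarith
  · rw [integral_sub (hk.const_mul _) (hkφ.const_mul _), integral_const_mul, integral_const_mul,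
      he.integral_eq_one γ hγ0]
    have h2 : ε / (4 * (C + 1)) * (2 * C) ≤ ε / 2 := by
      rw [div_mul_eq_mul_div, div_le_div_iff₀ (by positivity) (by positivity)]
      nlinarith
    nlinarith

/-- One factor of the square is bounded in sup norm, the other in `L¹`, where mollification is a
contraction. -/
theorem integral_norm_mollify_sub_sq_le {k : ℝ → ℝ} (h0 : ∀ t, 0 ≤ k t) (hk : Integrable k)
    (h1 : ∫ t, k t = 1) {f : ℝ → ℂ} (hf : Integrable f) {ε : ℝ}
    (h : ∀ x, ‖mollify k f x - f x‖ ≤ ε) :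
    ∫ x, ‖mollify k f x - f x‖ ^ 2 ≤ ε * (2 * ∫ x, ‖f x‖) := by
  have hm := integrable_mollify hk hf
  have hε : 0 ≤ ε := (norm_nonneg _).trans (h 0)
  calc ∫ x, ‖mollify k f x - f x‖ ^ 2 ≤ ∫ x, ε * (‖mollify k f x‖ + ‖f x‖) := by
        refine integral_mono_of_nonneg (ae_of_all _ fun x => by positivity)
          ((hm.norm.add hf.norm).const_mul ε) (ae_of_all _ fun x => ?_)
        simp only
        rw [pow_two]
        exact mul_le_mul (h x) (norm_sub_le _ _) (norm_nonneg _) hε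
    _ ≤ ε * (2 * ∫ x, ‖f x‖) := by
        rw [integral_const_mul, integral_add hm.norm hf.norm]
        have := integral_norm_mollify_le h0 hk h1 hf
        gcongr
        linarith

/-- Mean square distance of a mollified approximation. -/
theorem integral_norm_mollify_sub_sq_le_add {k : ℝ → ℝ} (h0 : ∀ t, 0 ≤ k t) (hk : Integrable k)
    (h1 : ∫ t, k t = 1) {f g : ℝ → ℂ} (hf : Integrable f) (hg : Integrable g) {C D : ℝ}
    (hC : ∀ x, ‖f x‖ ≤ C) (hD : ∀ x, ‖g x‖ ≤ D) {ε : ℝ} (h : ∀ x, ‖mollify k f x - f x‖ ≤ ε) :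
    ∫ x, ‖mollify k g x - f x‖ ^ 2 ≤
      2 * (∫ x, ‖g x - f x‖ ^ 2) + 2 * (ε * (2 * ∫ x, ‖f x‖)) := by
  have hgf : ∀ x, ‖g x - f x‖ ≤ D + C := fun x =>
    (norm_sub_le _ _).trans (add_le_add (hD x) (hC x))
  have b1 : ∀ x, ‖mollify k (fun x => g x - f x) x‖ ≤ D + C :=
    norm_mollify_le_of_norm_le h0 hk h1 hgf
  have i1 := integrable_norm_sq (integrable_mollify (g := fun x => g x - f x) hk (hg.sub hf)) b1
  have i2 := integrable_norm_sq (g := fun x => mollify k f x - f x)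
    ((integrable_mollify hk hf).sub hf) h
  calc ∫ x, ‖mollify k g x - f x‖ ^ 2
      ≤ ∫ x, (2 * ‖mollify k (fun x => g x - f x) x‖ ^ 2 + 2 * ‖mollify k f x - f x‖ ^ 2) := by
        refine integral_mono_of_nonneg (ae_of_all _ fun x => by positivity)
          ((i1.const_mul 2).add (i2.const_mul 2)) (ae_of_all _ fun x => ?_)
        simp only
        have e : mollify k g x - f x =
            mollify k (fun x => g x - f x) x + (mollify k f x - f x) := by
          rw [mollify_sub hk hg hf hD hC]
          ring
        rw [e]
        have := norm_add_le (mollify k (fun x => g x - f x) x) (mollify k f x - f x)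
        have h3 := pow_le_pow_left₀ (norm_nonneg _) this 2
        nlinarith [sq_nonneg (‖mollify k (fun x => g x - f x) x‖ - ‖mollify k f x - f x‖)]
    _ ≤ _ := by
        rw [integral_add (i1.const_mul 2) (i2.const_mul 2), integral_const_mul, integral_const_mul]
        have := integral_norm_mollify_sq_le h0 hk h1 (hg.sub hf) hgf
        have h4 := integral_norm_mollify_sub_sq_le h0 hk h1 hf h
        exact add_le_add (mul_le_mul_of_nonneg_left this two_pos.le)
          (mul_le_mul_of_nonneg_left h4 two_pos.le)

end Mollifier

/-! ### Convolution theorem and Fourier inversion -/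

theorem fourierT_eq_fourierInv (v : ℝ → ℂ) (y : ℝ) : fourierT v y = 𝓕⁻ v (y / (2 * Real.pi)) := by
  have hp := Real.pi_ne_zero
  unfold fourierT
  rw [Real.fourierInv_eq']
  refine integral_congr_ae (ae_of_all _ fun x => ?_)
  simp only [smul_eq_mul]
  congr 2
  simp only [RCLike.inner_apply, conj_trivial]
  rw [mul_comm]
  congr 2
  field_simp

theorem fourierT_mollify {k : ℝ → ℝ} {g : ℝ → ℂ} (hk : Integrable k) (hg : Integrable g) (y : ℝ) :
    fourierT (mollify k g) y = fourierT g y * fourierT (fun t => (k t : ℂ)) y := by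
  simp_rw [fourierT_eq_fourierInv, Real.fourierInv_eq_fourier_neg, mollify_eq_convolution]
  have hkc : Integrable fun t => (k t : ℂ) := hk.ofReal
  rw [Real.fourier_mul_convolution_eq hkc hg, mul_comm]

theorem integral_fourierT_mul {v w : ℝ → ℂ} (hv : Integrable v) (hw : Integrable w) :
    ∫ y, w y * fourierT v y = ∫ x, fourierT w x * v x := by
  have hi : Integrable (fun p : ℝ × ℝ => Complex.exp (Complex.I * ((p.2 * p.1 : ℝ) : ℂ)) *
      (w p.1 * v p.2)) (volume.prod volume) := by
    refine (hw.mul_prod hv).bdd_mul (c := 1) (Continuous.aestronglyMeasurable (by fun_prop))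
      (ae_of_all _ fun x => ?_)
    rw [norm_cexp_I_mul]
  calc ∫ y, w y * fourierT v y
      = ∫ y, ∫ x, Complex.exp (Complex.I * ((x * y : ℝ) : ℂ)) * (w y * v x) := by
        refine integral_congr_ae (ae_of_all _ fun y => ?_)
        simp only [fourierT]
        rw [← integral_const_mul]
        refine integral_congr_ae (ae_of_all _ fun x => ?_)
        simp only
        ring
    _ = ∫ x, ∫ y, Complex.exp (Complex.I * ((x * y : ℝ) : ℂ)) * (w y * v x) :=
        integral_integral_swap hi
    _ = _ := by
        refine integral_congr_ae (ae_of_all _ fun x => ?_)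
        simp only [fourierT]
        rw [← integral_mul_const]
        refine integral_congr_ae (ae_of_all _ fun y => ?_)
        simp only
        rw [mul_comm x y]
        ring

/-- Fourier inversion for an integrable function whose Fourier transform is square integrable. -/
theorem invFourierL2_fourierT {G : ℝ → ℂ} (hG : Integrable G)
    (hw : MemLp (fourierT G) 2 (volume : Measure ℝ)) : invFourierL2 (fourierT G) =ᵐ[volume] G := by
  have hp := Real.pi_pos
  have hpc : (Real.pi : ℂ) ≠ 0 := by exact_mod_cast hp.ne'
  have h2p : (0 : ℝ) < 2 * Real.pi := by positivity
  set W : Lp ℂ 2 (volume : Measure ℝ) := hw.toLp (fourierT G) with hW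
  -- Tested against smooth compactly supported `φ`: the `L²` transform agrees with the
  -- distributional one, so `𝓕` moves to `Φ`; the multiplication formula then moves `fourierT` from
  -- `G` onto `𝓕 Φ`, where it undoes `𝓕` up to scaling by `2π`.
  have key : (𝓕 W : Lp ℂ 2 (volume : Measure ℝ)) =ᵐ[volume]
      fun x => ((2 * Real.pi : ℝ) : ℂ) * G (2 * Real.pi * x) := by
    refine ae_eq_of_integral_contDiff_smul_eq
      ((Lp.memLp _).locallyIntegrable (by norm_num))
      (((hG.comp_mul_left' h2p.ne').const_mul _).locallyIntegrable) fun φ hφ hφc => ?_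
    have hφc' : HasCompactSupport (Complex.ofRealCLM ∘ φ) := hφc.comp_left rfl
    have hφ' : ContDiff ℝ ∞ (Complex.ofRealCLM ∘ φ) := by fun_prop
    set Φ : SchwartzMap ℝ ℂ := hφc'.toSchwartzMap hφ' with hΦ
    have hΦφ : ∀ x, Φ x = (φ x : ℂ) := fun x => rfl
    have e0 : ∫ x, Φ x • (𝓕 W : Lp ℂ 2 (volume : Measure ℝ)) x = ∫ x, (𝓕 Φ) x • W x := by
      rw [← Lp.toTemperedDistribution_apply, ← Lp.fourier_toTemperedDistribution_eq,
        TemperedDistribution.fourier_apply, Lp.toTemperedDistribution_apply]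
    have e1 : ∫ x, (𝓕 Φ) x • W x = ∫ x, (𝓕 Φ) x * fourierT G x := by
      refine integral_congr_ae ?_
      filter_upwards [hw.coeFn_toLp] with x hx
      rw [hx, smul_eq_mul]
    have e2 : ∀ x, fourierT (𝓕 Φ : SchwartzMap ℝ ℂ) x = φ (x / (2 * Real.pi)) := by
      intro x
      rw [fourierT_eq_fourierInv, ← SchwartzMap.fourierInv_coe, FourierTransform.fourierInv_fourier_eq,
        hΦφ]
    rw [integral_fourierT_mul hG (𝓕 Φ).integrable] at e1
    simp_rw [e2] at e1
    calc ∫ x, φ x • (𝓕 W : Lp ℂ 2 (volume : Measure ℝ)) x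
        = ∫ x, (φ (x / (2 * Real.pi)) : ℂ) * G x := by
          rw [← e1, ← e0]
          refine integral_congr_ae (ae_of_all _ fun x => ?_)
          simp [hΦφ]
      _ = ∫ x, φ x • (((2 * Real.pi : ℝ) : ℂ) * G (2 * Real.pi * x)) := by
          have h := Measure.integral_comp_mul_left
            (fun x => (φ (x / (2 * Real.pi)) : ℂ) * G x) (2 * Real.pi)
          have h' : ∫ x, (φ (x / (2 * Real.pi)) : ℂ) * G x = ((2 * Real.pi : ℝ) : ℂ) *
              ∫ x, (φ (2 * Real.pi * x / (2 * Real.pi)) : ℂ) * G (2 * Real.pi * x) := by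
            rw [h, abs_of_pos (inv_pos.2 h2p), Complex.real_smul, ← mul_assoc,
              ← Complex.ofReal_mul, mul_inv_cancel₀ h2p.ne', Complex.ofReal_one, one_mul]
          rw [h', ← integral_const_mul]
          refine integral_congr_ae (ae_of_all _ fun x => ?_)
          simp only [Complex.real_smul]
          rw [mul_div_cancel_left₀ _ h2p.ne']
          ring
  have hq : Measure.QuasiMeasurePreserving (fun x : ℝ => x / (2 * Real.pi)) volume volume := by
    simp_rw [div_eq_inv_mul]
    exact Measure.quasiMeasurePreserving_smul volume (inv_pos.2 h2p).ne'
  filter_upwards [hq.ae_eq_comp key] with x hx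
  simp only [Function.comp_apply] at hx
  rw [invFourierL2, dif_pos hw, hx, mul_div_cancel₀ _ h2p.ne']
  push_cast
  field_simp

/-! ### The smoothed estimate as a mollified truncated sum -/

theorem nsinc_sq_le (t : ℝ) : nsinc t ^ 2 ≤ 2 * (1 + (Real.pi * t) ^ 2)⁻¹ := by
  unfold nsinc
  set s := Real.pi * t
  have h1 : Real.sinc s ^ 2 ≤ 1 := (sq_le_one_iff_abs_le_one _).2 (Real.abs_sinc_le_one s)
  have h2 : s ^ 2 * Real.sinc s ^ 2 ≤ 1 := by
    rcases eq_or_ne s 0 with h | h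
    · simp [h]
    · rw [Real.sinc_of_ne_zero h, div_pow, mul_div_cancel₀ _ (pow_ne_zero 2 h)]
      exact Real.sin_sq_le_one s
  rw [← div_eq_mul_inv, le_div_iff₀ (by positivity)]
  linarith

theorem continuous_nsinc : Continuous nsinc :=
  Real.continuous_sinc.comp (continuous_const.mul continuous_id)

theorem memLp_nsinc {a : ℝ} (ha : a ≠ 0) (b : ℝ) :
    MemLp (fun y : ℝ => ((nsinc (a * y - b) : ℝ) : ℂ)) 2 volume := by
  have hc := continuous_nsinc
  have hp := Real.pi_ne_zero
  have hm : AEStronglyMeasurable (fun y : ℝ => ((nsinc (a * y - b) : ℝ) : ℂ)) volume :=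
    Continuous.aestronglyMeasurable (by fun_prop)
  rw [memLp_two_iff_integrable_sq_norm hm]
  have h1 : Integrable fun y : ℝ => 2 * (1 + (Real.pi * (a * y - b)) ^ 2)⁻¹ := by
    have := (((integrable_inv_one_add_sq.comp_mul_left' hp).comp_sub_right b).comp_mul_left'
      ha).const_mul 2
    exact this
  refine h1.mono' (hm.norm.pow 2) (ae_of_all _ fun y => ?_)
  rw [Complex.norm_real, norm_pow, norm_norm, Real.norm_eq_abs, sq_abs]
  exact nsinc_sq_le _

theorem continuous_fourierT {v : ℝ → ℂ} (hv : Integrable v) : Continuous (fourierT v) := by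
  refine continuous_of_dominated (fun y => (integrable_cexp_mul hv y).aestronglyMeasurable)
    (fun y => ae_of_all _ fun x => ?_) hv.norm (ae_of_all _ fun x => by fun_prop)
  rw [norm_mul, norm_cexp_I_mul, one_mul]

/-- The smoothed spectrum is square integrable. -/
theorem memLp_smoothedSpectrum (f : ℝ → ℂ) {e : ℝ → ℝ → ℝ} {γ : ℝ} (he : Integrable (e γ))
    {N : ℕ} (hN : 0 < N) {R : ℝ} (hR : 0 < R) : MemLp (smoothedSpectrum f e γ N R) 2 volume := by
  have hN' : (0 : ℝ) < N := by exact_mod_cast hN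
  have h1 : MemLp (interpolant f N R) 2 volume :=
    memLp_finsetSum _ fun n _ => (memLp_nsinc (div_pos hN' hR).ne' n).const_mul _
  refine MemLp.of_le_mul (c := ∫ x, ‖(e γ x : ℂ)‖) h1 (h1.aestronglyMeasurable.mul
    (continuous_fourierT he.ofReal).aestronglyMeasurable) (ae_of_all _ fun y => ?_)
  rw [smoothedSpectrum, norm_mul, mul_comm]
  exact mul_le_mul_of_nonneg_right (norm_fourierT_le _ y) (norm_nonneg _)

theorem integral_exp_mul_I_eq_sinc {L : ℝ} (y : ℝ) :
    ∫ x in (-L)..L, Complex.exp (Complex.I * ((x * y : ℝ) : ℂ)) =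
      ((2 * L * Real.sinc (L * y) : ℝ) : ℂ) := by
  rcases eq_or_ne y 0 with rfl | hy
  · simp
    ring
  rcases eq_or_ne L 0 with rfl | hL
  · simp
  have hy' : (y : ℂ) ≠ 0 := by exact_mod_cast hy
  have hL' : (L : ℂ) ≠ 0 := by exact_mod_cast hL
  have e : ∀ s : ℝ, Complex.exp (Complex.I * ((s * y : ℝ) : ℂ)) =
      Complex.exp (Complex.I * y * s) := fun s => by push_cast; ring_nf
  simp_rw [e]
  rw [integral_exp_mul_complex (mul_ne_zero Complex.I_ne_zero hy'),
    Real.sinc_of_ne_zero (mul_ne_zero hL hy)]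
  have h := Complex.two_sin ((L * y : ℝ) : ℂ)
  have e1 : Complex.I * y * (L : ℂ) = ((L * y : ℝ) : ℂ) * Complex.I := by push_cast; ring
  have e2 : Complex.I * y * ((-L : ℝ) : ℂ) = -((L * y : ℝ) : ℂ) * Complex.I := by push_cast; ring
  rw [e1, e2]
  have e3 : ((2 * L * (Real.sin (L * y) / (L * y)) : ℝ) : ℂ) =
      2 * Complex.sin ((L * y : ℝ) : ℂ) / y := by
    push_cast
    field_simp
  rw [e3, h, div_eq_div_iff (mul_ne_zero Complex.I_ne_zero hy') hy']
  linear_combination (Complex.exp (((L * y : ℝ) : ℂ) * Complex.I) -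
    Complex.exp (-((L * y : ℝ) : ℂ) * Complex.I)) * y * Complex.I_sq

/-- The interpolant is the Fourier transform of the truncated partial sum. -/
theorem fourierT_truncated (f : ℝ → ℂ) {N : ℕ} (hN : 0 < N) {R : ℝ} (hR : 0 < R) (y : ℝ) :
    fourierT (truncated f (R / N) N) y = interpolant f N R y := by
  have hN' : (0 : ℝ) < N := by exact_mod_cast hN
  set δ := R / N with hδ
  have hδ0 : 0 < δ := by positivity
  have hp := Real.pi_pos
  have hL : 0 < Real.pi / δ := by positivity
  have e1 : ∀ x, Complex.exp (Complex.I * ((x * y : ℝ) : ℂ)) * truncated f δ N x =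
      (Ioc (-(Real.pi / δ)) (Real.pi / δ)).indicator
        (fun x => ∑ n ∈ Finset.Icc (-(N : ℤ)) (N : ℤ),
          (((δ / (2 * Real.pi) : ℝ) : ℂ) * fourierT f (n * δ)) *
            Complex.exp (Complex.I * ((x * (y - n * δ) : ℝ) : ℂ))) x := by
    intro x
    unfold truncated
    by_cases hx : x ∈ Ioc (-(Real.pi / δ)) (Real.pi / δ)
    · rw [indicator_of_mem hx, indicator_of_mem hx, partialSum, ← mul_assoc, Finset.mul_sum]
      refine Finset.sum_congr rfl fun n _ => ?_
      rw [show ((x * (y - n * δ) : ℝ) : ℂ) = ((x * y : ℝ) : ℂ) + ((-(x * (n * δ)) : ℝ) : ℂ) by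
        push_cast; ring, mul_add, Complex.exp_add]
      ring
    · rw [indicator_of_notMem hx, indicator_of_notMem hx, mul_zero]
  unfold fourierT
  simp_rw [e1]
  rw [integral_indicator measurableSet_Ioc, ← intervalIntegral.integral_of_le (by linarith),
    intervalIntegral.integral_finsetSum
      (fun n _ => Continuous.intervalIntegrable (by fun_prop) _ _), interpolant]
  refine Finset.sum_congr rfl fun n _ => ?_
  rw [intervalIntegral.integral_const_mul, integral_exp_mul_I_eq_sinc, nsinc]
  -- The band half-width `π / δ` is what produces the sinc at the sampling nodes; the prefactor `(δ
  -- / 2π) · (2π / δ)` is `1`.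
  have e2 : Real.pi / δ * (y - n * δ) = Real.pi * (N / R * y - n) := by
    rw [hδ]
    field_simp
  rw [e2, mul_comm _ (fourierT f _), mul_assoc, ← Complex.ofReal_mul]
  congr 2
  field_simp

/-- The smoothed estimate is the mollification of the truncated partial sum. -/
theorem smoothedEstimate_ae_eq (f : ℝ → ℂ) {e : ℝ → ℝ → ℝ} {γ : ℝ} (he : Integrable (e γ))
    {N : ℕ} (hN : 0 < N) {R : ℝ} (hR : 0 < R) :
    smoothedEstimate f e γ N R =ᵐ[volume] mollify (e γ) (truncated f (R / N) N) := by
  have hg := integrable_truncated f (R / N) N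
  have h : smoothedSpectrum f e γ N R = fourierT (mollify (e γ) (truncated f (R / N) N)) := by
    ext y
    rw [fourierT_mollify he hg, fourierT_truncated f hN hR]
    rfl
  have hm := memLp_smoothedSpectrum f he hN hR
  rw [h] at hm
  rw [smoothedEstimate, h]
  exact invFourierL2_fourierT (integrable_mollify he hg) hm

theorem continuousAt_truncated (f : ℝ → ℂ) {δ : ℝ} (hδ : 0 < δ) (N : ℕ) {x : ℝ}
    (hx : x ∉ ({-(Real.pi / δ), Real.pi / δ} : Set ℝ)) : ContinuousAt (truncated f δ N) x := by
  have hp := Real.pi_pos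
  have hL : 0 < Real.pi / δ := by positivity
  refine ContinuousOn.continuousAt_indicator (continuous_partialSum f δ N).continuousOn ?_
  rwa [frontier_Ioc (by linarith)]

/-! ### The joint limit -/

theorem eLpNorm_two_le_of_integral_sq_le {h : ℝ → ℂ} (hh : MemLp h 2 volume) {c : ℝ} (hc : 0 ≤ c)
    (hle : ∫ x, ‖h x‖ ^ 2 ≤ c ^ 2) : eLpNorm h 2 volume ≤ ENNReal.ofReal c := by
  rw [hh.eLpNorm_eq_integral_rpow_norm two_ne_zero ENNReal.ofNat_ne_top]
  simp only [ENNReal.toReal_ofNat, Real.rpow_ofNat]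
  refine ENNReal.ofReal_le_ofReal ?_
  rw [← one_div, ← Real.sqrt_eq_rpow]
  exact Real.sqrt_le_iff.2 ⟨hc, hle⟩

/-- With `δ = R / N`, the condition `N / R → ∞` is `δ → 0`, and `N δ = R`. -/
theorem eventually_smoothingLimit {P : ℝ → Prop} (hP : ∀ᶠ γ in 𝓝[>] (0 : ℝ), P γ) {δ₀ R₀ : ℝ}
    (hδ₀ : 0 < δ₀) (hR₀ : 0 < R₀) : ∀ᶠ p : ℝ × ℕ × ℝ in smoothingLimit,
      (0 < p.1 ∧ P p.1) ∧ 0 < p.2.1 ∧ 0 < p.2.2 ∧ p.2.2 / p.2.1 < δ₀ ∧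
        R₀ < p.2.1 * (p.2.2 / p.2.1) := by
  have h1 : ∀ᶠ p : ℝ × ℕ × ℝ in smoothingLimit, 0 < p.1 ∧ P p.1 := by
    have : Tendsto (fun p : ℝ × ℕ × ℝ => p.1) smoothingLimit (𝓝[>] 0) :=
      tendsto_comap.mono_left (inf_le_left.trans inf_le_left)
    exact this.eventually (Eventually.and self_mem_nhdsWithin hP)
  have h2 : Tendsto (fun p : ℝ × ℕ × ℝ => p.2.2) smoothingLimit atTop :=
    tendsto_comap.mono_left (inf_le_left.trans inf_le_right)
  have h3 : Tendsto (fun p : ℝ × ℕ × ℝ => (p.2.1 : ℝ) / p.2.2) smoothingLimit atTop :=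
    tendsto_comap.mono_left inf_le_right
  filter_upwards [h1, h2.eventually_gt_atTop R₀, h3.eventually_gt_atTop δ₀⁻¹] with p hp1 hp2 hp3
  have hR : 0 < p.2.2 := hR₀.trans hp2
  have hN : (0 : ℝ) < p.2.1 := by
    have := (inv_pos.2 hδ₀).trans hp3
    rcases div_pos_iff.1 this with h | h
    · exact h.1
    · exact absurd h.2 (not_lt.2 hR.le)
  refine ⟨hp1, by exact_mod_cast hN, hR, ?_, ?_⟩
  · rw [inv_lt_comm₀ hδ₀ (div_pos hN hR), inv_div] at hp3
    exact hp3
  · rwa [mul_div_cancel₀ _ hN.ne']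

end AlphaSine

theorem mainTheorem10 (α : ℝ) (hα : -1 < α) (f : ℝ → ℂ)
    (hf_even : ∀ x, f (-x) = f x)
    (hf_L1w : AlphaSine.MemL1w α f)
    (hf_L2 : MemLp f 2 (volume : Measure ℝ))
    (hf_cont : Continuous f)
    (hf_deriv : AlphaSine.HasIntegrableDeriv f)
    (e : ℝ → ℝ → ℝ) (he : AlphaSine.IsMollifier e) :
    (∀ γ > 0, ∀ N : ℕ, 0 < N → ∀ R > 0,
      MemLp (AlphaSine.smoothedSpectrum f e γ N R) 2 (volume : Measure ℝ)) ∧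
    Tendsto
      (fun p : ℝ × ℕ × ℝ =>
        eLpNorm (fun x => AlphaSine.smoothedEstimate f e p.1 p.2.1 p.2.2 x - f x) 2
          (volume : Measure ℝ))
      AlphaSine.smoothingLimit (𝓝 0) ∧
    ((∃ C : ℝ, ∀ x, ‖f x‖ ≤ C) →
      ∃ F : ℝ → ℕ → ℝ → ℝ → ℂ,
        (∀ γ > 0, ∀ N : ℕ, 0 < N → ∀ R > 0,
          Continuous (F γ N R) ∧
          F γ N R =ᵐ[(volume : Measure ℝ)] AlphaSine.smoothedEstimate f e γ N R) ∧
        TendstoUniformly (fun p : ℝ × ℕ × ℝ => F p.1 p.2.1 p.2.2) f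
          AlphaSine.smoothingLimit) := by
  obtain ⟨f', hf', hd⟩ := hf_deriv
  have hf : Integrable f := AlphaSine.integrable_of_even hf_even hf_L1w.1
  have hfb := AlphaSine.norm_le_of_primitive hf hf' hd
  have huc : UniformContinuous f := by
    refine hf_cont.uniformContinuous_of_tendsto_cocompact (x := 0) ?_
    rw [cocompact_eq_atBot_atTop]
    exact (AlphaSine.tendsto_atBot_zero_of_primitive hf hf' hd).sup
      (AlphaSine.tendsto_atTop_zero_of_primitive hf hf' hd)
  have hgi := AlphaSine.integrable_truncated f
  have hgb : ∀ δ > 0, ∀ N x, ‖AlphaSine.truncated f δ N x‖ ≤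
      δ * (∫ t, ‖f t‖) + 2 * ∫ t, ‖f' t‖ := fun δ hδ N x =>
    (norm_indicator_le_norm_self _ _).trans (AlphaSine.norm_partialSum_le hf hf' hd hδ N x)
  refine ⟨fun γ hγ N hN R hR => AlphaSine.memLp_smoothedSpectrum f (he.integrable γ hγ) hN hR, ?_,
    fun _ => ⟨fun γ N R => AlphaSine.mollify (e γ) (AlphaSine.truncated f (R / N) N),
      fun γ hγ N hN R hR => ⟨?_,
        (AlphaSine.smoothedEstimate_ae_eq f (he.integrable γ hγ) hN hR).symm⟩, ?_⟩⟩
  · rw [ENNReal.tendsto_nhds_zero]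
    intro ε' hε'
    obtain ⟨ε, hε, hεε'⟩ : ∃ ε : ℝ, 0 < ε ∧ ENNReal.ofReal ε ≤ ε' := by
      obtain ⟨ε, hε1, hε2⟩ := ENNReal.lt_iff_exists_real_btwn.1 hε'
      exact ⟨ε, ENNReal.ofReal_pos.1 hε2.1, hε2.2.le⟩
    set A := ∫ t, ‖f t‖ with hA
    have hA0 : 0 ≤ A := integral_nonneg fun _ => norm_nonneg _
    -- Each of the two squared errors enters doubled, so each is allotted `ε² / 4`; the
    -- mollification error carries the factor `2 A`.
    obtain ⟨δ₀, hδ₀, R₀, hR₀, h⟩ := AlphaSine.exists_forall_integral_norm_truncated_sub_sq_le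
      hf hf' hd (show 0 < ε ^ 2 / 4 by positivity)
    filter_upwards [AlphaSine.eventually_smoothingLimit (he.eventually_norm_mollify_sub_le hf huc hfb
      (show 0 < ε ^ 2 / (8 * (A + 1)) by positivity)) hδ₀ hR₀] with p ⟨⟨hγ, hγf⟩, hN, hR, hδ, hNR⟩
    have hN' : (0 : ℝ) < p.2.1 := by exact_mod_cast hN
    have hδ' : 0 < p.2.2 / p.2.1 := div_pos hR hN'
    have hk := he.integrable _ hγ
    have hk0 := he.nonneg _ hγ
    have hk1 := he.integral_eq_one _ hγ
    have hm := AlphaSine.integrable_mollify hk (hgi (p.2.2 / p.2.1) p.2.1)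
    have hmb := AlphaSine.norm_mollify_le_of_norm_le hk0 hk hk1 (hgb _ hδ' p.2.1)
    have hmem : MemLp (AlphaSine.mollify (e p.1) (AlphaSine.truncated f (p.2.2 / p.2.1) p.2.1)) 2
        volume := by
      rw [memLp_two_iff_integrable_sq_norm hm.aestronglyMeasurable]
      exact AlphaSine.integrable_norm_sq hm hmb
    refine le_trans ?_ hεε'
    refine (eLpNorm_congr_ae ((AlphaSine.smoothedEstimate_ae_eq f hk hN hR).sub
      (ae_eq_refl f))).trans_le ?_
    refine AlphaSine.eLpNorm_two_le_of_integral_sq_le (hmem.sub hf_L2) hε.le ?_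
    refine (AlphaSine.integral_norm_mollify_sub_sq_le_add hk0 hk hk1 hf (hgi _ _) hfb
      (hgb _ hδ' p.2.1) hγf).trans ?_
    have h1 := h _ _ hδ' hδ hNR
    have h2 : ε ^ 2 / (8 * (A + 1)) * (2 * A) ≤ ε ^ 2 / 4 := by
      rw [div_mul_eq_mul_div, div_le_div_iff₀ (by positivity) (by positivity)]
      nlinarith [sq_nonneg ε]
    linarith
  · have hδ : 0 < R / N := div_pos hR (by exact_mod_cast hN)
    exact AlphaSine.continuous_mollify (he.integrable γ hγ) (hgi _ _) (hgb _ hδ N)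
      (Set.to_countable _) fun x hx => AlphaSine.continuousAt_truncated f hδ N hx
  · rw [Metric.tendstoUniformly_iff]
    intro ε hε
    obtain ⟨δ₀, hδ₀, R₀, hR₀, h⟩ := AlphaSine.exists_forall_norm_truncated_sub_le
      hf hf' hd (show 0 < ε / 3 by positivity)
    filter_upwards [AlphaSine.eventually_smoothingLimit (he.eventually_norm_mollify_sub_le hf huc hfb
      (show 0 < ε / 3 by positivity)) hδ₀ hR₀] with p ⟨⟨hγ, hγf⟩, hN, hR, hδ, hNR⟩ x
    have hN' : (0 : ℝ) < p.2.1 := by exact_mod_cast hN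
    have hδ' : 0 < p.2.2 / p.2.1 := div_pos hR hN'
    have hk := he.integrable _ hγ
    -- The sup norm contraction is applied to the difference between the truncated sum and `f`.
    have h1 := AlphaSine.norm_mollify_le_of_norm_le (he.nonneg _ hγ) hk (he.integral_eq_one _ hγ)
      (h _ _ hδ' hδ hNR) x
    rw [AlphaSine.mollify_sub hk (hgi _ _) hf (hgb _ hδ' p.2.1) hfb] at h1
    rw [dist_comm, dist_eq_norm]
    refine (norm_sub_le_norm_sub_add_norm_sub _ (AlphaSine.mollify (e p.1) f x) _).trans_lt ?_
    linarith [hγf x]
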